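/- Let $N=2^n$ with $n\ge 1$. Consider the bucket-brigade QRAM for $N$ one-bit cells $x_a$, $a\in\{0,1\}^n$: the routers are the internal vertices of the complete binary tree of depth $n$, and each router consists of four registers $t$ (status), $in$, $L$, $R$, each with the basis $|w\rangle$ (inactive), $|0\rangle$, $|1\rangle$, initially $|w\rangle$. A query sends the address qubits $a_0,\dots,a_{n-1}$ and then the bus into the tree in a pipelined way: $a_\ell$ becomes the status of the router at depth $\ell$ on its path, by a local SWAP of $in$ and $t$; a later qubit is routed through that router by the two CSWAPs that exchange $in$ with $L$ (if $t=0$) and with $R$ (if $t=1$), and a long-range SWAP moves it to the child router. The bit $x_a$ is then written on the bus at the leaf, and the route-in circuit is run in reverse. (i) Planar layout. The registers can be placed at distinct sites of the square grid in an H-tree pattern, inside a square of side $O(\sqrt N)$, such that all local gates act on neighbouring sites and gates performed at the same time act on disjoint registers; only the long-range SWAPs (parent to child router, and address or bus qubit to the entry of the tree) act on distant sites. (ii) Infidelity. Suppose that every operation is followed, independently and with at most the stated probability, by an arbitrary quantum channel on the registers it acts on: $\varepsilon_s$ for a local SWAP, $\varepsilon_{cs}$ for a CSWAP, $\varepsilon_I$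 for a register idling for one unit of time (and for the writing of a data bit), and $3\min(m\,\varepsilon_Q,\varepsilon_f)$ for a long-range SWAP over distance $m$, which consists of three long-range CNOTs done with a GHZ state of length $m$ (error $\varepsilon_Q$ per qubit) or a distilled Bell pair (error $\varepsilon_f$). Let $\varepsilon_L$ be an upper bound for $\min(m\,\varepsilon_Q,\varepsilon_f)$ over all long-range operations of the circuit. Suppose that a long-range operation over distance $m$, with its entanglement distillation, takes time at most $A(1+\log m)^k$, with $A,k\in\mathbb N$ fixed. For an input $\sum_a\alpha_a|a\rangle|0\rangle$ with $\sum_a|\alpha_a|^2=1$ let $\rho$ be the resulting state of address and bus, and let the infidelity be $1-\langle\psi|\rho|\psi\rangle$ with $\psi=\sum_a\alpha_a|a\rangle|x_a\rangle$. Then the infidelity is $$O\left(\log^2 N\,\varepsilon_L+\log N\,\varepsilon_s+\log^2 N\,\varepsilon_{cs}+\operatorname{polylog}(N)\,\varepsilon_I\right),$$ where the constant and the exponent of the polylogarithm depend only on $A$ and $k$, and not on $N$, the data, the input state, the error rates or the error channels. -/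

import Mathlib

open scoped Matrix ComplexOrder

noncomputable section

namespace BucketBrigade

/-! ### Registers -/

/-- A quantum register of the memory is a three-level system with basis `|w⟩ = none` (the inactive
"wait" state) and `|0⟩ = some false`, `|1⟩ = some true`. -/
abbrev Level := Option Bool

/-- The CSWAP routers of a memory with `N = 2 ^ n` cells: the non-leaf vertices of the complete
binary tree of depth `n`. A router at depth `ℓ < n` is named by the `ℓ` address bits that lead to it
from the root. -/
abbrev Node (n : ℕ) := {l : List Bool // l.length < n}

instance Node.instFintype (n : ℕ) : Fintype (Node n) :=
  (List.finite_length_lt Bool n).fintype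

/-- The root router `R₀`. -/
def Node.root {n : ℕ} (hn : 0 < n) : Node n := ⟨[], hn⟩

/-- The left (`b = false`) or right (`b = true`) child of a router. -/
def Node.child {n : ℕ} (v : Node n) (b : Bool) (h : v.1.length + 1 < n) : Node n :=
  ⟨v.1 ++ [b], by simpa using h⟩

/-- The registers that the user of the memory holds: number `k < n` is the address qubit `a_k`, and
number `n` is the bus qubit. -/
abbrev Ext (n : ℕ) := Fin (n + 1)

/-- The internal registers: one entry register in front of the root, and the four registers
`t`, `in`, `L`, `R` of every router. -/
inductive Inner (n : ℕ) where
  | entry : Inner n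
  | status (v : Node n) : Inner n
  | inp (v : Node n) : Inner n
  | out (v : Node n) (b : Bool) : Inner n
deriving DecidableEq, Fintype

abbrev Reg (n : ℕ) := Ext n ⊕ Inner n

abbrev Reg.ext {n : ℕ} (k : Ext n) : Reg n := Sum.inl k
abbrev Reg.entry {n : ℕ} : Reg n := Sum.inr Inner.entry
/-- The status register `t` of a router. -/
abbrev Reg.status {n : ℕ} (v : Node n) : Reg n := Sum.inr (Inner.status v)
/-- The incident register `in` of a router. -/
abbrev Reg.inp {n : ℕ} (v : Node n) : Reg n := Sum.inr (Inner.inp v)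
/-- The output register `L` (`b = false`) or `R` (`b = true`) of a router. -/
abbrev Reg.out {n : ℕ} (v : Node n) (b : Bool) : Reg n := Sum.inr (Inner.out v b)

/-- Basis states of the whole memory. -/
abbrev Config (n : ℕ) := Reg n → Level

/-- Operators on the Hilbert space of the whole memory, in particular density matrices. -/
abbrev Op (n : ℕ) := Matrix (Config n) (Config n) ℂ

/-! ### Planar H-tree layout -/

/-- The direction of the left (`b = false`) or right (`b = true`) output of a router that is entered
in direction `d`. -/
def turn (d : ℤ × ℤ) (b : Bool) : ℤ × ℤ :=
  if b then (-d.2, d.1) else (d.2, -d.1)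

/-- The distance on the grid from a router with `h ≥ 1` router levels below it to its children. -/
def branchLength (h : ℕ) : ℤ := 3 * 2 ^ (h / 2)

/-- Follow the address bits `l` down the H-tree from a router at site `p` that is entered in direction
`d` and has `h` router levels below it. Returns the site and the entry direction of the router
reached. -/
def walk : ℕ → ℤ × ℤ → ℤ × ℤ → List Bool → (ℤ × ℤ) × (ℤ × ℤ)
  | _, p, d, [] => (p, d)
  | h, p, d, b :: l => walk (h - 1) (p + branchLength h • turn d b) (turn d b) l

/-- The site of the incident register of a router, and the direction in which it is entered. -/
def frame {n : ℕ} (v : Node n) : (ℤ × ℤ) × (ℤ × ℤ) := walk (n - 1) (0, 0) (0, -1) v.1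

/-- The H-tree layout on the square grid. The four registers of a router form a T: `in` is in the
middle, `L` and `R` are on its two sides and `t` is ahead of it. The children of a router lie straight
behind its two outputs. The entry register is in front of the root and the address and bus qubits
stand in a column beside it, in the gap between the two halves of the tree. -/
def place {n : ℕ} : Reg n → ℤ × ℤ
  | Sum.inl k => (1, (k : ℤ) + 1)
  | Sum.inr Inner.entry => (0, 1)
  | Sum.inr (Inner.inp v) => (frame v).1
  | Sum.inr (Inner.status v) => (frame v).1 + (frame v).2
  | Sum.inr (Inner.out v b) => (frame v).1 + turn (frame v).2 b

/-- Distance of two registers along the edges of the grid. -/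
def gridDist {n : ℕ} (a b : Reg n) : ℕ :=
  ((place a).1 - (place b).1).natAbs + ((place a).2 - (place b).2).natAbs

/-! ### Gates -/

/-- The elementary operations. -/
inductive Gate (n : ℕ) where
  /-- local SWAP -/
  | swap (a b : Reg n) : Gate n
  /-- local CSWAP: exchange `a` and `b` if the register `t` holds the bit `c` -/
  | cswap (c : Bool) (t a b : Reg n) : Gate n
  /-- long-range SWAP -/
  | longSwap (a b : Reg n) : Gate n
  /-- classically controlled `X`, which loads a memory bit `d` -/
  | write (q : Reg n) (d : Bool) : Gate n

/-- The registers that a gate acts on. -/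
def Gate.support {n : ℕ} : Gate n → Finset (Reg n)
  | swap a b => {a, b}
  | cswap _ t a b => {t, a, b}
  | longSwap a b => {a, b}
  | write q _ => {q}

/-- The action of a gate on basis states; `X` exchanges `|0⟩` and `|1⟩` and fixes `|w⟩`. -/
def Gate.act {n : ℕ} : Gate n → Config n → Config n
  | swap a b, c => c ∘ Equiv.swap a b
  | cswap v t a b, c => if c t = some v then c ∘ Equiv.swap a b else c
  | longSwap a b, c => c ∘ Equiv.swap a b
  | write q d, c => if d then Function.update c q ((c q).map not) else c

/-- The operator of a gate. -/
def Gate.op {n : ℕ} (g : Gate n) : Op n :=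
  Matrix.of fun c c' => if c = g.act c' then 1 else 0

/-- Local gates act on neighbouring sites of the grid; in a CSWAP, the register `a` is a neighbour of
the control `t` and of the other target `b`. -/
def Gate.NearestNeighbour {n : ℕ} : Gate n → Prop
  | swap a b => gridDist a b = 1
  | cswap _ t a b => gridDist t a = 1 ∧ gridDist a b = 1
  | longSwap _ _ => True
  | write _ _ => True

/-- Time that a gate takes, in units of one local gate, when a long-range operation (with the
distillation of its Bell pairs) over distance `m` takes time `dur m`. -/
def Gate.time {n : ℕ} (dur : ℕ → ℕ) : Gate n → ℕ
  | longSwap a b => dur (gridDist a b)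
  | _ => 1

/-! ### The query circuit

The qubits `a_0, …, a_{n-1}` and the bus (number `n`) are sent into the tree one after the other,
without waiting for the previous one to arrive. Qubit `k` leaves its place at time `4 * k` and visits
the router at depth `ℓ` of its path at times `4 * k + 3 * ℓ + 1, …, 4 * k + 3 * ℓ + 4`: it arrives in
the incident register and then either becomes the status of the router, if `k = ℓ`, or is routed to
one of the outputs by two CSWAPs and sent on to the child, if `ℓ < k`. -/

/-- The gates at router `v` that serve qubit `k` at time `t`. -/
def routerGates {n : ℕ} (t : ℕ) (v : Node n) (k : Ext n) : List (Gate n) :=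
  let ℓ := v.1.length
  (if ℓ = 0 ∧ t = 4 * k.val + 1 then [Gate.swap Reg.entry (Reg.inp v)] else []) ++
  (if ℓ = k.val ∧ t = 4 * k.val + 3 * ℓ + 2 then [Gate.swap (Reg.inp v) (Reg.status v)] else []) ++
  (if ℓ < k.val ∧ t = 4 * k.val + 3 * ℓ + 2 then
    [Gate.cswap false (Reg.status v) (Reg.inp v) (Reg.out v false)] else []) ++
  (if ℓ < k.val ∧ t = 4 * k.val + 3 * ℓ + 3 then
    [Gate.cswap true (Reg.status v) (Reg.inp v) (Reg.out v true)] else []) ++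
  (if h : v.1.length + 1 < n then
    if ℓ < k.val ∧ t = 4 * k.val + 3 * ℓ + 4 then
      [Gate.longSwap (Reg.out v false) (Reg.inp (v.child false h)),
       Gate.longSwap (Reg.out v true) (Reg.inp (v.child true h))]
    else []
  else [])

/-- All gates of the route-in phase at time `t`. -/
def layer (n t : ℕ) : List (Gate n) :=
  ((List.finRange (n + 1)).flatMap fun k =>
    if t = 4 * k.val then [Gate.longSwap (Reg.ext k) Reg.entry] else []) ++
  ((Finset.univ : Finset (Node n)).toList.flatMap fun v =>
    (List.finRange (n + 1)).flatMap fun k => routerGates t v k)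

/-- Setting of the router statuses and route-in of the bus. -/
def routeIn (n : ℕ) : List (List (Gate n)) :=
  (List.range (7 * n + 1)).map (layer n)

/-- The memory bits are loaded at the outputs of the last routers. -/
def loadData {n : ℕ} (x : (Fin n → Bool) → Bool) : List (Gate n) :=
  (Finset.univ : Finset (Node n)).toList.flatMap fun v =>
    if v.1.length + 1 = n then
      [false, true].map fun b =>
        Gate.write (Reg.out v b) (x fun m => (v.1 ++ [b]).getD m.val false)
    else []

/-- The whole query: route-in, loading of the data, and the route-in circuit in reverse (all its
gates are their own inverses). -/
def circuit {n : ℕ} (x : (Fin n → Bool) → Bool) : List (List (Gate n)) :=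
  routeIn n ++ [loadData x] ++ (routeIn n).reverse

/-- The circuit is laid out in the plane with local connectivity: no two registers share a site, the
local gates act on neighbouring sites, and the gates of one layer act on disjoint sets of registers. -/
def IsPlanarLocal {n : ℕ} (x : (Fin n → Bool) → Bool) : Prop :=
  Function.Injective (place (n := n)) ∧
  ∀ L ∈ circuit x, (∀ g ∈ L, g.NearestNeighbour) ∧
    L.Pairwise fun g g' => Disjoint g.support g'.support

/-! ### Noise -/

/-- The operator on the whole memory that acts as `A` on the registers in `S` and as the identity on
all others. -/
def embed {n : ℕ} (S : Finset (Reg n)) (A : Matrix (S → Level) (S → Level) ℂ) : Op n :=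
  Matrix.of fun c c' =>
    if ∀ q, q ∉ S → c q = c' q then A (fun q => c q) (fun q => c' q) else 0

/-- A possible fault: with probability `prob` an arbitrary quantum channel, given by Kraus operators,
hits the registers in `S`. -/
structure Fault {n : ℕ} (S : Finset (Reg n)) where
  prob : ℝ
  prob_nonneg : 0 ≤ prob
  prob_le_one : prob ≤ 1
  numKraus : ℕ
  kraus : Fin numKraus → Matrix (S → Level) (S → Level) ℂ
  trace_preserving : ∑ i, (kraus i)ᴴ * kraus i = 1

def Fault.apply {n : ℕ} {S : Finset (Reg n)} (f : Fault S) (ρ : Op n) : Op n :=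
  ((1 - f.prob : ℝ) : ℂ) • ρ +
    (f.prob : ℂ) • ∑ i, embed S (f.kraus i) * ρ * (embed S (f.kraus i))ᴴ

/-- Independent faults of all operations: `gate s g` follows the gate `g` in layer `s`, and
`idle s r q` hits the register `q` in the `r`-th unit of time of layer `s`. -/
structure Noise (n : ℕ) where
  gate : (s : ℕ) → (g : Gate n) → Fault g.support
  idle : (s r : ℕ) → (q : Reg n) → Fault {q}

/-- Error probabilities of the components: a physical qubit, a distilled Bell pair, a local SWAP, a
local CSWAP, and idling for a unit of time. -/
structure Rates where
  qubit : ℝ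
  bell : ℝ
  swap : ℝ
  cswap : ℝ
  idle : ℝ
  qubit_nonneg : 0 ≤ qubit
  bell_nonneg : 0 ≤ bell
  swap_nonneg : 0 ≤ swap
  cswap_nonneg : 0 ≤ cswap
  idle_nonneg : 0 ≤ idle

/-- The error of one long-range operation over distance `m`: it uses a GHZ state of length `m` or a
distilled Bell pair, whichever is better. -/
def Rates.longRange (ε : Rates) (m : ℕ) : ℝ := min (m * ε.qubit) ε.bell

/-- The error probability of a gate. A long-range SWAP consists of three long-range CNOTs. -/
def Rates.gate {n : ℕ} (ε : Rates) : Gate n → ℝ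
  | Gate.swap _ _ => ε.swap
  | Gate.cswap _ _ _ _ => ε.cswap
  | Gate.longSwap a b => 3 * ε.longRange (gridDist a b)
  | Gate.write _ _ => ε.idle

/-- All fault probabilities are at most the given error rates. -/
def Noise.IsBoundedBy {n : ℕ} (𝒩 : Noise n) (ε : Rates) : Prop :=
  (∀ s g, (𝒩.gate s g).prob ≤ ε.gate g) ∧ ∀ s r q, (𝒩.idle s r q).prob ≤ ε.idle

/-! ### The noisy query and its infidelity -/

/-- Duration of a layer: that of its slowest gate, and at least one unit of time. -/
def layerTime {n : ℕ} (dur : ℕ → ℕ) (L : List (Gate n)) : ℕ :=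
  (L.map (Gate.time dur)).foldr max 1

/-- Noisy gates of layer `s`, followed by noisy idling of all registers for the duration of the
layer. -/
def noisyLayer {n : ℕ} (dur : ℕ → ℕ) (𝒩 : Noise n) (s : ℕ) (L : List (Gate n)) (ρ : Op n) : Op n :=
  (List.range (layerTime dur L)).foldl
    (fun ρ r => (Finset.univ : Finset (Reg n)).toList.foldl
      (fun ρ q => (𝒩.idle s r q).apply ρ) ρ)
    (L.foldl (fun ρ g => (𝒩.gate s g).apply (g.op * ρ * g.opᴴ)) ρ)

/-- Run the layers, numbered from `s` on. -/
def noisyRun {n : ℕ} (dur : ℕ → ℕ) (𝒩 : Noise n) : ℕ → List (List (Gate n)) → Op n → Op n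
  | _, [], ρ => ρ
  | s, L :: Ls, ρ => noisyRun dur 𝒩 (s + 1) Ls (noisyLayer dur 𝒩 s L ρ)

/-- The basis state `|a⟩|b⟩` of the address qubits and the bus. -/
def extBasis {n : ℕ} (a : Fin n → Bool) (b : Bool) : Ext n → Level :=
  Fin.snoc (α := fun _ => Level) (fun m => some (a m)) (some b)

/-- The input state `∑ a, α a |a⟩|0⟩` with all internal registers in `|w⟩`. -/
def inputState {n : ℕ} (α : (Fin n → Bool) → ℂ) : Config n → ℂ :=
  fun c => ∑ a, if c = Sum.elim (extBasis a false) (fun _ => none) then α a else 0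

/-- The ideal result `∑ a, α a |a⟩|x a⟩` of the query. -/
def idealOutput {n : ℕ} (x : (Fin n → Bool) → Bool) (α : (Fin n → Bool) → ℂ) :
    (Ext n → Level) → ℂ :=
  fun e => ∑ a, if e = extBasis a (x a) then α a else 0

/-- Partial trace over the internal registers. -/
def traceInner {n : ℕ} (ρ : Op n) : Matrix (Ext n → Level) (Ext n → Level) ℂ :=
  Matrix.of fun e e' => ∑ f : Inner n → Level, ρ (Sum.elim e f) (Sum.elim e' f)

/-- The final state of address and bus after a noisy query. -/
def outputState {n : ℕ} (dur : ℕ → ℕ) (𝒩 : Noise n) (x : (Fin n → Bool) → Bool)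
    (α : (Fin n → Bool) → ℂ) : Matrix (Ext n → Level) (Ext n → Level) ℂ :=
  traceInner (noisyRun dur 𝒩 0 (circuit x)
    (Matrix.vecMulVec (inputState α) (star (inputState α))))

/-- The query infidelity `1 - ⟨ψ| ρ |ψ⟩`, for the final state `ρ` of address and bus and the ideal
result `ψ`. -/
def infidelity {n : ℕ} (dur : ℕ → ℕ) (𝒩 : Noise n) (x : (Fin n → Bool) → Bool)
    (α : (Fin n → Bool) → ℂ) : ℝ :=
  1 - (star (idealOutput x α) ⬝ᵥ (outputState dur 𝒩 x α *ᵥ idealOutput x α)).re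

end BucketBrigade

end

open scoped Matrix ComplexOrder

noncomputable section

namespace BucketBrigade

variable {n : ℕ}

/-! The infidelity bound rests on the fact that a bucket brigade keeps errors local: a fault harms
only those addresses whose root-to-leaf path it touches, and a path has only O(n) registers although
the tree has exponentially many.

Each noisy step is a convex combination of "the fault occurs" and "it does not", so the infidelity,
which is the real part of a linear functional (`defect`) of the final operator, is the mean of its
values over all fault patterns (`re_noisyEvolve`). Fix a pattern. Let `s` be the set of addresses
whose paths no fault touches, `K` the union of these paths, and W the weight of the other addresses
in the input. For `a ∈ s` the state stays a product of an ideal basis state on `K`, which depends on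
`a`, and a state off `K`, which does not. The reason is that every gate acts inside `K`, or outside
`K`, or is a CSWAP whose control in `K` does not hold the bit that would trigger it
(`Gate.IsRouting.respects`); faults act only off `K` (`evolve_branches_le`). The ideal part is
computed from a closed formula for the position of every qubit at every time (`idealState`,
`run_circuit`). At the end all internal registers in `K` are inactive again, so the good part is the
restriction of the ideal output to `s`, tensored with one common internal state, and its defect is
at most W(1 - W) (`defect_branches_le`).

The bad part has defect at most its squared norm W. The defect is nonnegative on pure states, so the
parallelogram identity `dyad_add_dyad_sub` bounds the defect of the sum by 2(W + W) = 4W. By a union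
bound W is at most the sum over `a` of |α a|² times the number of faults on the path of `a`. Taking
means, the infidelity is at most four times the largest expected number of faults on a single path
(`infidelity_le_of_risk`).

It remains to count. A path meets one router per depth, and each of the n + 1 qubits passes a router
once, with boundedly many gates. This gives O(n²) CSWAPs and long-range SWAPs, but only O(n) local
SWAPs, which happen once per qubit at the root and once per router for storing. Idling costs O(n)
layers times O(n) registers times the duration of a layer, which is O(n^k) because distances on the
grid are at most exponential in n.

The layout is planar because the two subtrees of a router lie in strips on opposite sides of it,
separated by a margin (`portSite_cons`), so the address can be read off from the site bit by bit.
The side is O(√N) because branch lengths double every two levels. -/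

/-! ### Operators on part of the registers -/

/-- The configuration `c` with the registers in `S` overwritten by `a`. -/
def overwrite (S : Finset (Reg n)) (a : S → Level) (c : Config n) : Config n :=
  fun q => if h : q ∈ S then a ⟨q, h⟩ else c q

/-- Splitting a configuration into its parts on and off `S` makes the operator a Kronecker product
with an identity; products and adjoints of embedded operators are then inherited from Kronecker
products. -/
theorem embed_eq_kronecker (S : Finset (Reg n)) (A : Matrix (S → Level) (S → Level) ℂ) :
    embed S A = (Matrix.kronecker A (1 : Matrix ({q // q ∉ S} → Level) _ ℂ)).submatrix
      (Equiv.piEquivPiSubtypeProd (· ∈ S) fun _ => Level)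
      (Equiv.piEquivPiSubtypeProd (· ∈ S) fun _ => Level) := by
  ext c c'
  simp [embed, Matrix.one_apply, funext_iff, Equiv.piEquivPiSubtypeProd]

theorem embed_one (S : Finset (Reg n)) : embed S (1 : Matrix (S → Level) (S → Level) ℂ) = 1 := by
  rw [embed_eq_kronecker, Matrix.kronecker, Matrix.kroneckerMap_one_one _ (by simp) (by simp)
    (by simp), Matrix.submatrix_one_equiv]

theorem embed_mul (S : Finset (Reg n)) (A B : Matrix (S → Level) (S → Level) ℂ) :
    embed S (A * B) = embed S A * embed S B := by
  simp only [embed_eq_kronecker, Matrix.submatrix_mul_equiv, Matrix.kronecker,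
    ← Matrix.mul_kronecker_mul, one_mul]

theorem embed_conjTranspose (S : Finset (Reg n)) (A : Matrix (S → Level) (S → Level) ℂ) :
    (embed S A)ᴴ = embed S Aᴴ := by
  simp only [embed_eq_kronecker, Matrix.conjTranspose_submatrix, Matrix.kronecker,
    Matrix.conjTranspose_kronecker, Matrix.conjTranspose_one]

theorem embed_sum {ι : Type*} (s : Finset ι) (S : Finset (Reg n))
    (A : ι → Matrix (S → Level) (S → Level) ℂ) :
    embed S (∑ i ∈ s, A i) = ∑ i ∈ s, embed S (A i) := by
  ext c c'
  simp only [embed, Matrix.of_apply, Matrix.sum_apply]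
  split_ifs <;> simp

theorem Fault.sum_embed_kraus {S : Finset (Reg n)} (f : Fault S) :
    ∑ i, (embed S (f.kraus i))ᴴ * embed S (f.kraus i) = 1 := by
  simp only [embed_conjTranspose, ← embed_mul, ← embed_sum, f.trace_preserving, embed_one]

theorem embed_mulVec (S : Finset (Reg n)) (A : Matrix (S → Level) (S → Level) ℂ)
    (v : Config n → ℂ) (c : Config n) :
    (embed S A *ᵥ v) c = ∑ a, A (fun q => c q) a * v (overwrite S a c) := by
  rw [Matrix.mulVec, dotProduct,
    ← (Equiv.piEquivPiSubtypeProd (· ∈ S) fun _ => Level).symm.sum_comp, Fintype.sum_prod_type]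
  refine Finset.sum_congr rfl fun a _ => ?_
  have single (F : ({q // q ∉ S} → Level) → ℂ) (hF : ∀ o, o ≠ (fun q => c q.1) → F o = 0) :
      ∑ o, F o = F fun q => c q.1 := Fintype.sum_eq_single _ hF
  refine (single _ ?_).trans ?_
  · intro o ho
    rw [embed, Matrix.of_apply, if_neg, zero_mul]
    intro h
    refine ho (funext fun q => ?_)
    have := h q.1 q.2
    simpa [Equiv.piEquivPiSubtypeProd, q.2] using this.symm
  · rw [embed, Matrix.of_apply, if_pos]
    · congr 2
      ext q : 1
      simp [Equiv.piEquivPiSubtypeProd]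
    · intro q hq
      simp [Equiv.piEquivPiSubtypeProd, hq]

/-! ### Pure states -/

/-- The density matrix of a pure state. -/
def dyad (v : Config n → ℂ) : Op n := Matrix.vecMulVec v (star v)

def normSq (v : Config n → ℂ) : ℝ := ∑ c, ‖v c‖ ^ 2

theorem conj_dyad (M : Op n) (v : Config n → ℂ) : M * dyad v * Mᴴ = dyad (M *ᵥ v) := by
  rw [dyad, dyad, Matrix.mul_vecMulVec, Matrix.vecMulVec_mul, Matrix.star_mulVec]

/-- Parallelogram identity. For a linear functional that is nonnegative on evolved dyads the
difference term can be dropped, so interference between good and bad addresses costs only a factor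
2. -/
theorem dyad_add_dyad_sub (v w : Config n → ℂ) :
    dyad (v + w) + dyad (v - w) = (2 : ℂ) • dyad v + (2 : ℂ) • dyad w := by
  ext c c'
  simp [dyad, Matrix.vecMulVec_apply]
  ring

theorem star_dotProduct_self (v : Config n → ℂ) : star v ⬝ᵥ v = (normSq v : ℂ) := by
  simp [dotProduct, normSq, Complex.conj_mul']

theorem trace_dyad (v : Config n → ℂ) : (dyad v).trace = (normSq v : ℂ) := by
  rw [dyad, Matrix.trace_vecMulVec, dotProduct_comm, star_dotProduct_self]

theorem sum_normSq_mulVec {ι : Type*} [Fintype ι] (M : ι → Op n)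
    (h : ∑ i, (M i)ᴴ * M i = 1) (v : Config n → ℂ) :
    ∑ i, normSq (M i *ᵥ v) = normSq v := by
  apply Complex.ofReal_injective
  push_cast
  simp only [← star_dotProduct_self, Matrix.star_mulVec, ← Matrix.dotProduct_mulVec,
    Matrix.mulVec_mulVec]
  rw [← dotProduct_sum, ← Matrix.sum_mulVec, h, Matrix.one_mulVec]

theorem trace_sum_conj {ι : Type*} [Fintype ι] (M : ι → Op n)
    (h : ∑ i, (M i)ᴴ * M i = 1) (ρ : Op n) :
    (∑ i, M i * ρ * (M i)ᴴ).trace = ρ.trace := by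
  rw [Matrix.trace_sum]
  simp only [Matrix.trace_mul_comm (_ * ρ), ← mul_assoc]
  rw [← Matrix.trace_sum, ← Finset.sum_mul, h, one_mul]

/-! ### Reversible gates -/

theorem Gate.op_mulVec {g : Gate n} (hg : Function.Involutive g.act) (v : Config n → ℂ) :
    g.op *ᵥ v = v ∘ g.act := by
  ext c
  rw [Matrix.mulVec, dotProduct, Finset.sum_eq_single (g.act c)]
  · simp [Gate.op, hg c]
  · intro c' _ h
    rw [Gate.op, Matrix.of_apply, if_neg, zero_mul]
    rintro rfl
    exact h (hg c').symm
  · simp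

theorem Gate.conjTranspose_op_mul_op {g : Gate n} (hg : Function.Involutive g.act) :
    g.opᴴ * g.op = 1 := by
  ext c c'
  simp only [Matrix.mul_apply, Matrix.conjTranspose_apply, Gate.op, Matrix.of_apply]
  simp only [Matrix.one_apply, apply_ite, star_one, star_zero, mul_one, mul_zero,
    Finset.sum_ite_eq', Finset.mem_univ, if_true, hg.injective.eq_iff]
  simp [eq_comm]

theorem normSq_op_mulVec {g : Gate n} (hg : Function.Involutive g.act) (v : Config n → ℂ) :
    normSq (g.op *ᵥ v) = normSq v := by
  rw [Gate.op_mulVec hg]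
  exact Equiv.sum_comp hg.toPerm fun c => ‖v c‖ ^ 2

/-! ### Noisy evolutions -/

/-- An elementary step of a noisy evolution. -/
inductive Event (n : ℕ) where
  | gate (g : Gate n) : Event n
  | fault (S : Finset (Reg n)) (f : Fault S) : Event n

/-- The effect of a step if its fault, if it is one, does occur. -/
def Event.map : Event n → Op n →ₗ[ℂ] Op n
  | gate g => LinearMap.mulRight ℂ g.opᴴ ∘ₗ LinearMap.mulLeft ℂ g.op
  | fault S f => ∑ i, LinearMap.mulRight ℂ (embed S (f.kraus i))ᴴ ∘ₗ
      LinearMap.mulLeft ℂ (embed S (f.kraus i))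

/-- The effect of a step if its fault, if it is one, occurs with its probability. -/
def Event.noisyMap : Event n → Op n →ₗ[ℂ] Op n
  | gate g => (gate g).map
  | fault S f => ((1 - f.prob : ℝ) : ℂ) • LinearMap.id + (f.prob : ℂ) • (fault S f).map

def evolve (l : List (Event n)) (ρ : Op n) : Op n := l.foldl (fun ρ e => e.map ρ) ρ

def noisyEvolve (l : List (Event n)) (ρ : Op n) : Op n := l.foldl (fun ρ e => e.noisyMap ρ) ρ

/-- The gates among a list of steps. -/
def gatesOf (l : List (Event n)) : List (Gate n) :=
  l.flatMap fun e => match e with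
    | .gate g => [g]
    | .fault _ _ => []

/-- The mean of a function of the steps that really happen: gates always do, faults independently
with their probabilities. -/
def mean : List (Event n) → (List (Event n) → ℝ) → ℝ
  | [], Φ => Φ []
  | .gate g :: l, Φ => mean l fun r => Φ (.gate g :: r)
  | .fault S f :: l, Φ => (1 - f.prob) * mean l Φ + f.prob * mean l fun r => Φ (.fault S f :: r)

/-- Gates are never omitted from a sample, so a comparison is needed only for samples with the full
gate sequence. The weights are nonnegative because fault probabilities lie in [0, 1]. -/
theorem mean_mono {l : List (Event n)} {Φ Ψ : List (Event n) → ℝ}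
    (h : ∀ r, gatesOf r = gatesOf l → Φ r ≤ Ψ r) : mean l Φ ≤ mean l Ψ := by
  induction l generalizing Φ Ψ with
  | nil => exact h _ rfl
  | cons e l ih =>
    cases e with
    | gate g => exact ih fun r hr => h _ (by simpa [gatesOf] using hr)
    | fault S f =>
      refine add_le_add (mul_le_mul_of_nonneg_left (ih fun r hr => h _ (by simpa [gatesOf] using hr))
        (sub_nonneg.2 f.prob_le_one)) (mul_le_mul_of_nonneg_left
        (ih fun r hr => h _ (by simpa [gatesOf] using hr)) f.prob_nonneg)

/-- The mean weight of a step whose weight counts only if it is a fault that happens. -/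
def Event.meanWeight (w : Event n → ℝ) : Event n → ℝ
  | gate _ => 0
  | fault S f => f.prob * w (fault S f)

/-- The mean weight of the faults that happen. -/
theorem mean_sum (w : Event n → ℝ) (hw : ∀ g, w (.gate g) = 0) (l : List (Event n)) (x : ℝ) :
    mean l (fun r => x + (r.map w).sum) = x + (l.map (Event.meanWeight w)).sum := by
  induction l generalizing x with
  | nil => simp [mean]
  | cons e l ih =>
    cases e with
    | gate g => simpa [mean, hw, Event.meanWeight] using ih x
    | fault S f =>
      simp only [mean, List.map_cons, List.sum_cons, ← add_assoc, ih, Event.meanWeight]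
      ring

/-- By linearity each fault splits the evolution into two alternatives with real weights; expanding
all of them gives the mean over fault patterns. -/
theorem re_noisyEvolve (Λ : Op n →ₗ[ℂ] ℂ) (l : List (Event n)) (ρ : Op n) :
    (Λ (noisyEvolve l ρ)).re = mean l fun r => (Λ (evolve r ρ)).re := by
  have add (l : List (Event n)) (ρ σ : Op n) :
      noisyEvolve l (ρ + σ) = noisyEvolve l ρ + noisyEvolve l σ := by
    induction l generalizing ρ σ with
    | nil => rfl
    | cons e l ih => simp only [noisyEvolve, List.foldl_cons, map_add] at ih ⊢; rw [ih]
  have smul (l : List (Event n)) (z : ℂ) (ρ : Op n) :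
      noisyEvolve l (z • ρ) = z • noisyEvolve l ρ := by
    induction l generalizing ρ with
    | nil => rfl
    | cons e l ih => simp only [noisyEvolve, List.foldl_cons, map_smul] at ih ⊢; rw [ih]
  induction l generalizing ρ with
  | nil => rfl
  | cons e l ih =>
    cases e with
    | gate g => exact ih _
    | fault S f =>
      change (Λ (noisyEvolve l (((1 - f.prob : ℝ) : ℂ) • ρ +
        (f.prob : ℂ) • (Event.fault S f).map ρ))).re = _
      rw [add, smul, smul, map_add, map_smul, map_smul, Complex.add_re, smul_eq_mul, smul_eq_mul,
        Complex.re_ofReal_mul, Complex.re_ofReal_mul, ih, ih]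
      rfl

theorem trace_noisyEvolve {l : List (Event n)}
    (hl : ∀ g ∈ gatesOf l, Function.Involutive g.act) (ρ : Op n) :
    (noisyEvolve l ρ).trace = ρ.trace := by
  induction l generalizing ρ with
  | nil => rfl
  | cons e l ih =>
    change (noisyEvolve l (e.noisyMap ρ)).trace = _
    rw [ih fun g hg => hl g (by simp only [gatesOf, List.flatMap_cons]; exact List.mem_append_right _ hg)]
    cases e with
    | gate g =>
      have hg := hl g (by simp [gatesOf])
      simp only [Event.noisyMap, Event.map, LinearMap.comp_apply, LinearMap.mulLeft_apply,
        LinearMap.mulRight_apply]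
      rw [Matrix.trace_mul_comm, ← mul_assoc, Gate.conjTranspose_op_mul_op hg, one_mul]
    | fault S f =>
      simp only [Event.noisyMap, Event.map, LinearMap.add_apply, LinearMap.smul_apply,
        LinearMap.id_apply, LinearMap.sum_apply, LinearMap.comp_apply, LinearMap.mulLeft_apply,
        LinearMap.mulRight_apply, Matrix.trace_add, Matrix.trace_smul,
        trace_sum_conj _ f.sum_embed_kraus, ← add_smul]
      push_cast
      simp

theorem Event.map_gate_dyad {g : Gate n} (v : Config n → ℂ) :
    (Event.gate g).map (dyad v) = dyad (g.op *ᵥ v) := conj_dyad _ _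

theorem Event.map_fault_dyad {S : Finset (Reg n)} (f : Fault S) (v : Config n → ℂ) :
    (Event.fault S f).map (dyad v) = ∑ i, dyad (embed S (f.kraus i) *ᵥ v) := by
  simp [Event.map, conj_dyad]

theorem evolve_sum {ι : Type*} (s : Finset ι) (l : List (Event n)) (ρ : ι → Op n) :
    evolve l (∑ i ∈ s, ρ i) = ∑ i ∈ s, evolve l (ρ i) := by
  induction l generalizing ρ with
  | nil => rfl
  | cons e l ih => simp only [evolve, List.foldl_cons, map_sum] at ih ⊢; rw [ih]

theorem evolve_add (l : List (Event n)) (ρ σ : Op n) :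
    evolve l (ρ + σ) = evolve l ρ + evolve l σ := by
  induction l generalizing ρ σ with
  | nil => rfl
  | cons e l ih => simp only [evolve, List.foldl_cons, map_add] at ih ⊢; rw [ih]

theorem evolve_smul (l : List (Event n)) (z : ℂ) (ρ : Op n) :
    evolve l (z • ρ) = z • evolve l ρ := by
  induction l generalizing ρ with
  | nil => rfl
  | cons e l ih => simp only [evolve, List.foldl_cons, map_smul] at ih ⊢; rw [ih]

theorem evolve_dyad_nonneg (Λ : Op n →ₗ[ℂ] ℂ) (hΛ : ∀ v, 0 ≤ (Λ (dyad v)).re)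
    (l : List (Event n)) (v : Config n → ℂ) : 0 ≤ (Λ (evolve l (dyad v))).re := by
  induction l generalizing v with
  | nil => exact hΛ v
  | cons e l ih =>
    change 0 ≤ (Λ (evolve l (e.map (dyad v)))).re
    cases e with
    | gate g => rw [Event.map_gate_dyad]; exact ih _
    | fault S f =>
      rw [Event.map_fault_dyad, evolve_sum, map_sum, Complex.re_sum]
      exact Finset.sum_nonneg fun i _ => ih _

/-- Gates are isometries, and the Kraus operators of a fault split a pure state into unnormalised
pure states whose squared norms add up to the original one, so the bound survives every step. -/
theorem evolve_dyad_le (Λ : Op n →ₗ[ℂ] ℂ) (hΛ : ∀ v, (Λ (dyad v)).re ≤ normSq v)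
    (l : List (Event n)) (hl : ∀ g ∈ gatesOf l, Function.Involutive g.act) (v : Config n → ℂ) :
    (Λ (evolve l (dyad v))).re ≤ normSq v := by
  induction l generalizing v with
  | nil => exact hΛ v
  | cons e l ih =>
    change (Λ (evolve l (e.map (dyad v)))).re ≤ _
    have ih := ih fun g hg => hl g (by
      simp only [gatesOf, List.flatMap_cons]; exact List.mem_append_right _ hg)
    cases e with
    | gate g =>
      rw [Event.map_gate_dyad, ← normSq_op_mulVec (hl g (by simp [gatesOf])) v]
      exact ih _
    | fault S f =>
      rw [Event.map_fault_dyad, evolve_sum, map_sum, Complex.re_sum,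
        ← sum_normSq_mulVec _ f.sum_embed_kraus v]
      exact Finset.sum_le_sum fun i _ => ih _

/-! ### Locality of gates -/

theorem Gate.act_of_notMem {g : Gate n} {q : Reg n} (hq : q ∉ g.support) (c : Config n) :
    g.act c q = c q := by
  cases g with
  | swap a b =>
    simp only [Gate.support, Finset.mem_insert, Finset.mem_singleton, not_or] at hq
    simp [Gate.act, Equiv.swap_apply_of_ne_of_ne hq.1 hq.2]
  | longSwap a b =>
    simp only [Gate.support, Finset.mem_insert, Finset.mem_singleton, not_or] at hq
    simp [Gate.act, Equiv.swap_apply_of_ne_of_ne hq.1 hq.2]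
  | cswap v t a b =>
    simp only [Gate.support, Finset.mem_insert, Finset.mem_singleton, not_or] at hq
    simp only [Gate.act]
    split_ifs <;> simp [Equiv.swap_apply_of_ne_of_ne hq.2.1 hq.2.2]
  | write a d =>
    simp only [Gate.support, Finset.mem_singleton] at hq
    simp only [Gate.act]
    split_ifs <;> simp [Function.update_of_ne hq]

theorem swap_apply_mem {a b q : Reg n} {s : Finset (Reg n)} (ha : a ∈ s) (hb : b ∈ s)
    (hq : q ∈ s) : Equiv.swap a b q ∈ s := by
  rw [Equiv.swap_apply_def]
  split_ifs <;> assumption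

theorem Gate.act_congr {g : Gate n} {c c' : Config n} (h : ∀ q ∈ g.support, c q = c' q) {q : Reg n}
    (hq : q ∈ g.support) : g.act c q = g.act c' q := by
  cases g with
  | swap a b => exact h _ (swap_apply_mem (by simp [Gate.support]) (by simp [Gate.support]) hq)
  | longSwap a b => exact h _ (swap_apply_mem (by simp [Gate.support]) (by simp [Gate.support]) hq)
  | cswap v t a b =>
    simp only [Gate.act, h t (by simp [Gate.support])]
    split_ifs
    · exact h _ (swap_apply_mem (by simp [Gate.support]) (by simp [Gate.support]) hq)
    · exact h _ hq
  | write a d =>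
    obtain rfl : q = a := by simpa [Gate.support] using hq
    simp only [Gate.act]
    split_ifs <;> simp [h q hq]

/-- The control of a CSWAP is not one of its targets. -/
def Gate.IsProper : Gate n → Prop
  | cswap _ t a b => t ≠ a ∧ t ≠ b
  | _ => True

theorem Gate.IsProper.involutive {g : Gate n} (hg : g.IsProper) : Function.Involutive g.act := by
  intro c
  cases g with
  | swap a b => ext q; simp [Gate.act]
  | longSwap a b => ext q; simp [Gate.act]
  | cswap v t a b =>
    simp only [Gate.act]
    by_cases h : c t = some v
    · ext q
      simp [h, Equiv.swap_apply_of_ne_of_ne hg.1 hg.2]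
    · simp [h]
  | write a d =>
    cases d
    · rfl
    · ext q
      by_cases hq : q = a
      · subst hq
        simp [Gate.act, Function.comp_def]
      · simp [Gate.act, Function.update_of_ne hq]

/-- Run a list of gates on a basis state. -/
def runGates (L : List (Gate n)) (c : Config n) : Config n := L.foldl (fun c g => g.act c) c

/-! ### Branches that share the state of the registers off a clean set -/

/-- The state which is `c₀` on the registers in `K` and `φ` on the others. -/
def branch (K : Finset (Reg n)) (c₀ : Config n) (φ : Config n → ℂ) : Config n → ℂ :=
  fun c => if ∀ q ∈ K, c q = c₀ q then φ c else 0

/-- The function `φ` depends only on the registers off `K`. -/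
def IgnoresOn (K : Finset (Reg n)) (φ : Config n → ℂ) : Prop :=
  ∀ c c', (∀ q, q ∉ K → c q = c' q) → φ c = φ c'

/-- The gate `g`, applied to the basis state `c` on `K` and any state off `K`, does not entangle `K`
with the other registers. -/
def Gate.Respects (K : Finset (Reg n)) (c : Config n) (g : Gate n) : Prop :=
  Disjoint g.support K ∨ g.support ⊆ K ∨ ∃ b t p q, g = .cswap b t p q ∧ t ∈ K ∧ c t ≠ some b

/-- All gates of a list respect `K` on the way from the basis state `c`. -/
def RespectAll (K : Finset (Reg n)) : List (Gate n) → Config n → Prop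
  | [], _ => True
  | g :: L, c => g.Respects K c ∧ RespectAll K L (g.act c)

theorem op_mulVec_branch_of_disjoint {g : Gate n} (hg : Function.Involutive g.act)
    {K : Finset (Reg n)} (h : Disjoint g.support K) (c₀ : Config n) (φ : Config n → ℂ) :
    g.op *ᵥ branch K c₀ φ = branch K (g.act c₀) (φ ∘ g.act) := by
  have key (c : Config n) : ∀ q ∈ K, g.act c q = c q := fun q hq =>
    Gate.act_of_notMem (Finset.disjoint_right.1 h hq) c
  rw [Gate.op_mulVec hg]
  ext c
  simp only [branch, Function.comp_apply]
  congr 1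
  exact propext (forall₂_congr fun q hq => by rw [key _ q hq, key _ q hq])

theorem IgnoresOn.comp_act {g : Gate n} {K : Finset (Reg n)} (h : Disjoint g.support K)
    {φ : Config n → ℂ} (hφ : IgnoresOn K φ) : IgnoresOn K (φ ∘ g.act) := by
  intro c c' hc
  refine hφ _ _ fun q hq => ?_
  by_cases hqg : q ∈ g.support
  · exact Gate.act_congr (fun r hr => hc r (Finset.disjoint_left.1 h hr)) hqg
  · rw [Gate.act_of_notMem hqg, Gate.act_of_notMem hqg, hc q hq]

theorem op_mulVec_branch_of_subset {g : Gate n} (hg : Function.Involutive g.act)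
    {K : Finset (Reg n)} (h : g.support ⊆ K) (c₀ : Config n) {φ : Config n → ℂ}
    (hφ : IgnoresOn K φ) : g.op *ᵥ branch K c₀ φ = branch K (g.act c₀) φ := by
  have key {c c' : Config n} (hc : ∀ q ∈ K, c q = c' q) : ∀ q ∈ K, g.act c q = g.act c' q := by
    intro q hq
    by_cases hqg : q ∈ g.support
    · exact Gate.act_congr (fun r hr => hc r (h hr)) hqg
    · rw [Gate.act_of_notMem hqg, Gate.act_of_notMem hqg, hc q hq]
  rw [Gate.op_mulVec hg]
  ext c
  simp only [branch, Function.comp_apply]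
  have e : (∀ q ∈ K, g.act c q = c₀ q) ↔ ∀ q ∈ K, c q = g.act c₀ q :=
    ⟨fun H => by simpa only [hg c] using key H, fun H => by simpa only [hg c₀] using key H⟩
  rw [hφ (g.act c) c fun q hq => Gate.act_of_notMem (fun hqg => hq (h hqg)) c]
  simp only [e]

/-- The state on `K` fixes the control to a value that does not trigger the exchange, so the gate is
the identity on this branch even if one target lies in `K` and the other does not. -/
theorem op_mulVec_branch_cswap {b : Bool} {t p q : Reg n}
    (hg : Function.Involutive (Gate.cswap b t p q).act) {K : Finset (Reg n)} (ht : t ∈ K)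
    {c₀ : Config n} (hc : c₀ t ≠ some b) (φ : Config n → ℂ) :
    (Gate.cswap b t p q).op *ᵥ branch K c₀ φ = branch K ((Gate.cswap b t p q).act c₀) φ := by
  have key {c : Config n} (h : c t ≠ some b) : (Gate.cswap b t p q).act c = c := if_neg h
  rw [Gate.op_mulVec hg, key hc]
  ext c
  simp only [branch, Function.comp_apply]
  by_cases h : c t = some b
  · have h' : ¬ ∀ q ∈ K, c q = c₀ q := fun H => hc (by rw [← H t ht, h])
    rw [if_neg h', if_neg]
    intro H
    have h1 : (Gate.cswap b t p q).act c t ≠ some b := by rw [H t ht]; exact hc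
    have h2 := key h1
    rw [hg c] at h2
    rw [← h2] at h1
    exact h1 h
  · rw [key h]

theorem overwrite_of_mem {S : Finset (Reg n)} {q : Reg n} (h : q ∈ S) (a : S → Level)
    (c : Config n) : overwrite S a c q = a ⟨q, h⟩ := dif_pos h

theorem overwrite_of_notMem {S : Finset (Reg n)} {q : Reg n} (h : q ∉ S) (a : S → Level)
    (c : Config n) : overwrite S a c q = c q := dif_neg h

theorem embed_mulVec_branch {S K : Finset (Reg n)} (h : Disjoint S K)
    (A : Matrix (S → Level) (S → Level) ℂ) (c₀ : Config n) (φ : Config n → ℂ) :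
    embed S A *ᵥ branch K c₀ φ = branch K c₀ (embed S A *ᵥ φ) := by
  have key (c : Config n) (a : S → Level) :
      (∀ q ∈ K, overwrite S a c q = c₀ q) ↔ ∀ q ∈ K, c q = c₀ q :=
    forall₂_congr fun q hq => by rw [overwrite_of_notMem (Finset.disjoint_right.1 h hq)]
  ext c
  rw [embed_mulVec]
  simp only [branch, embed_mulVec, key]
  split_ifs <;> simp

theorem IgnoresOn.embed_mulVec {S K : Finset (Reg n)} (h : Disjoint S K)
    (A : Matrix (S → Level) (S → Level) ℂ) {φ : Config n → ℂ} (hφ : IgnoresOn K φ) :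
    IgnoresOn K (embed S A *ᵥ φ) := by
  intro c c' hc
  rw [BucketBrigade.embed_mulVec, BucketBrigade.embed_mulVec]
  refine Finset.sum_congr rfl fun a _ => ?_
  congr 1
  · congr 1
    exact funext fun q => hc q (Finset.disjoint_left.1 h q.2)
  · refine hφ _ _ fun q hq => ?_
    by_cases hS : q ∈ S
    · rw [overwrite_of_mem hS, overwrite_of_mem hS]
    · rw [overwrite_of_notMem hS, overwrite_of_notMem hS, hc q hq]

/-- A linear functional bounded on superpositions of branches with a common state off `K` is bounded
on them before any evolution whose faults avoid `K` and whose gates respect `K`. -/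
theorem evolve_branches_le (Λ : Op n →ₗ[ℂ] ℂ) {K : Finset (Reg n)} {ι : Type*} (s : Finset ι)
    (α : ι → ℂ) (M : ℝ) (cEnd : ι → Config n)
    (hEnd : ∀ φ, IgnoresOn K φ → (Λ (dyad (∑ i ∈ s, α i • branch K (cEnd i) φ))).re ≤
      M * ∑ i ∈ s, ‖α i‖ ^ 2 * normSq (branch K (cEnd i) φ))
    (l : List (Event n)) (hinv : ∀ g ∈ gatesOf l, Function.Involutive g.act)
    (hl : ∀ S f, .fault S f ∈ l → Disjoint S K) (c : ι → Config n)
    (hc : ∀ i ∈ s, RespectAll K (gatesOf l) (c i))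
    (hcEnd : ∀ i ∈ s, runGates (gatesOf l) (c i) = cEnd i) (φ : Config n → ℂ)
    (hφ : IgnoresOn K φ) :
    (Λ (evolve l (dyad (∑ i ∈ s, α i • branch K (c i) φ)))).re ≤
      M * ∑ i ∈ s, ‖α i‖ ^ 2 * normSq (branch K (c i) φ) := by
  induction l generalizing c φ with
  | nil =>
    have hcEnd : ∀ i ∈ s, c i = cEnd i := hcEnd
    have h₁ : ∑ i ∈ s, α i • branch K (c i) φ = ∑ i ∈ s, α i • branch K (cEnd i) φ :=
      Finset.sum_congr rfl fun i hi => by rw [hcEnd i hi]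
    have h₂ : ∑ i ∈ s, ‖α i‖ ^ 2 * normSq (branch K (c i) φ) =
        ∑ i ∈ s, ‖α i‖ ^ 2 * normSq (branch K (cEnd i) φ) :=
      Finset.sum_congr rfl fun i hi => by rw [hcEnd i hi]
    rw [h₁, h₂]
    exact hEnd φ hφ
  | cons e l ih =>
    change (Λ (evolve l (e.map (dyad _)))).re ≤ _
    cases e with
    | gate g =>
      have hg : Function.Involutive g.act := hinv g (by simp [gatesOf])
      have ih := ih (fun g' hg' => hinv g' (by simpa [gatesOf] using Or.inr hg'))
        (fun S f hf => hl S f (List.mem_cons_of_mem _ hf)) (fun i => g.act (c i))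
        (fun i hi => (hc i hi).2) (fun i hi => hcEnd i hi)
      -- The new state off `K` must be the same for all `i`. Whether the support is disjoint from
      -- `K` does not depend on `i`; if it is, the gate transforms `φ` alone, and otherwise `φ` is
      -- unchanged in every branch.
      obtain ⟨φ', hφ', h⟩ : ∃ φ', IgnoresOn K φ' ∧
          ∀ i ∈ s, g.op *ᵥ branch K (c i) φ = branch K (g.act (c i)) φ' := by
        by_cases h1 : Disjoint g.support K
        · exact ⟨_, hφ.comp_act h1, fun i _ => op_mulVec_branch_of_disjoint hg h1 _ _⟩
        refine ⟨φ, hφ, fun i hi => ?_⟩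
        obtain h | h | ⟨b, t, p, q, rfl, ht, h⟩ := (hc i hi).1
        · exact absurd h h1
        · exact op_mulVec_branch_of_subset hg h _ hφ
        · exact op_mulVec_branch_cswap hg ht h _
      rw [Event.map_gate_dyad, Matrix.mulVec_sum]
      simp only [Matrix.mulVec_smul]
      have h' : ∑ i ∈ s, α i • (g.op *ᵥ branch K (c i) φ) =
          ∑ i ∈ s, α i • branch K (g.act (c i)) φ' :=
        Finset.sum_congr rfl fun i hi => by rw [h i hi]
      have h'' : ∑ i ∈ s, ‖α i‖ ^ 2 * normSq (branch K (c i) φ) =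
          ∑ i ∈ s, ‖α i‖ ^ 2 * normSq (branch K (g.act (c i)) φ') :=
        Finset.sum_congr rfl fun i hi => by rw [← h i hi, normSq_op_mulVec hg]
      rw [h', h'']
      exact ih φ' hφ'
    | fault S f =>
      have hS := hl S f List.mem_cons_self
      have ih := ih (fun g' hg' => hinv g' (by simpa [gatesOf] using hg'))
        (fun S f hf => hl S f (List.mem_cons_of_mem _ hf)) c
        (fun i hi => hc i hi) (fun i hi => hcEnd i hi)
      -- The Kraus pieces are not normalised. A bound that is homogeneous in `normSq` can be applied
      -- to each of them and added up again.
      have h : ∑ i ∈ s, ‖α i‖ ^ 2 * normSq (branch K (c i) φ) =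
          ∑ j, ∑ i ∈ s, ‖α i‖ ^ 2 * normSq (branch K (c i) (embed S (f.kraus j) *ᵥ φ)) := by
        rw [Finset.sum_comm]
        refine Finset.sum_congr rfl fun i _ => ?_
        rw [← Finset.mul_sum, ← sum_normSq_mulVec _ f.sum_embed_kraus]
        simp only [embed_mulVec_branch hS]
      rw [Event.map_fault_dyad, evolve_sum, map_sum, Complex.re_sum, h, Finset.mul_sum]
      refine Finset.sum_le_sum fun j _ => ?_
      rw [Matrix.mulVec_sum]
      simp only [Matrix.mulVec_smul, embed_mulVec_branch hS]
      exact ih _ (hφ.embed_mulVec hS _)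

/-! ### Geometry of the H-tree -/

/-- Unit vectors along the axes of the grid. -/
def IsDir (d : ℤ × ℤ) : Prop := d = (1, 0) ∨ d = (-1, 0) ∨ d = (0, 1) ∨ d = (0, -1)

theorem IsDir.turn {d : ℤ × ℤ} (hd : IsDir d) (b : Bool) : IsDir (turn d b) := by
  rcases hd with rfl | rfl | rfl | rfl <;> cases b <;> simp [IsDir, BucketBrigade.turn]

/-- How far a subtree with `h` router levels below its root extends sideways from its root. -/
def sideSpan : ℕ → ℤ
  | 0 => 1
  | 1 => 4
  | h + 2 => branchLength (h + 2) + sideSpan h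

/-- How far a subtree with `h` router levels below its root extends along the direction in which its
root is entered. -/
def alongSpan : ℕ → ℤ
  | 0 => 1
  | h + 1 => sideSpan h

theorem sideSpan_succ (h : ℕ) : sideSpan (h + 1) = branchLength (h + 1) + alongSpan h := by
  cases h <;> rfl

theorem branchLength_add_two (h : ℕ) : branchLength (h + 2) = 2 * branchLength h := by
  rw [branchLength, branchLength, show (h + 2) / 2 = h / 2 + 1 by omega, pow_succ]
  ring

theorem branchLength_pos (h : ℕ) : 0 < branchLength h := by
  unfold branchLength
  positivity

/-- Spans are geometric sums of branch lengths that double every two levels, so they stay below the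
next branch length; the margin 2 leaves room for the outputs of the parent router. -/
theorem sideSpan_add_two_le : ∀ h, sideSpan h + 2 ≤ branchLength (h + 2)
  | 0 => by simp [sideSpan, branchLength]
  | 1 => by simp [sideSpan, branchLength]
  | h + 2 => by
    rw [sideSpan, branchLength_add_two (h + 2)]
    linarith [sideSpan_add_two_le h]

theorem alongSpan_add_two_le : ∀ h, alongSpan h + 2 ≤ branchLength (h + 1)
  | 0 => by simp [alongSpan, branchLength]
  | h + 1 => sideSpan_add_two_le h

theorem one_le_sideSpan : ∀ h, 1 ≤ sideSpan h
  | 0 => by simp [sideSpan]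
  | 1 => by simp [sideSpan]
  | h + 2 => by
    rw [sideSpan]
    linarith [one_le_sideSpan h, branchLength_pos (h + 2)]

theorem one_le_alongSpan : ∀ h, 1 ≤ alongSpan h
  | 0 => le_rfl
  | h + 1 => one_le_sideSpan h

/-- Position of the registers of a router that is entered in direction `d`, relative to its incident
register `none`: the status register is `some none` and the outputs are `some (some b)`. -/
def portOffset (d : ℤ × ℤ) : Option (Option Bool) → ℤ × ℤ
  | none => 0
  | some none => d
  | some (some b) => turn d b

/-- The site of a register of the router reached by the address bits `l`. -/
def portSite (h : ℕ) (p d : ℤ × ℤ) (l : List Bool) (x : Option (Option Bool)) : ℤ × ℤ :=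
  (walk h p d l).1 + portOffset (walk h p d l).2 x

/-- Inner product of integer vectors. -/
def dotp (u v : ℤ × ℤ) : ℤ := u.1 * v.1 + u.2 * v.2

theorem walk_isDir (h : ℕ) (p : ℤ × ℤ) {d : ℤ × ℤ} (hd : IsDir d) (l : List Bool) :
    IsDir (walk h p d l).2 := by
  induction l generalizing h p d with
  | nil => exact hd
  | cons b l ih => exact ih _ _ (hd.turn b)

/-- Each turn exchanges the sideways and the forward direction, so the two bounds are proved
together, each feeding the other one level up. -/
theorem portSite_bounds {h : ℕ} (p : ℤ × ℤ) {d : ℤ × ℤ} (hd : IsDir d) {l : List Bool}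
    (hl : l.length ≤ h) (x : Option (Option Bool)) :
    |dotp (portSite h p d l x - p) d| ≤ alongSpan h ∧
      |dotp (portSite h p d l x - p) (turn d true)| ≤ sideSpan h := by
  induction l generalizing h p d with
  | nil =>
    have h1 := one_le_alongSpan h
    have h2 := one_le_sideSpan h
    simp only [abs_le]
    rcases hd with rfl | rfl | rfl | rfl <;> rcases x with _ | _ | _ | _ <;>
      simp [portSite, walk, portOffset, turn, dotp] <;> omega
  | cons b l ih =>
    obtain ⟨h, rfl⟩ : ∃ k, h = k + 1 := ⟨h - 1, by simp at hl; omega⟩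
    have ih := ih (h := h) (p + branchLength (h + 1) • turn d b) (hd.turn b) (by simpa using hl)
    rw [show portSite (h + 1) p d (b :: l) x =
      portSite h (p + branchLength (h + 1) • turn d b) (turn d b) l x from rfl]
    rw [sideSpan_succ, show alongSpan (h + 1) = sideSpan h from rfl]
    generalize portSite h (p + branchLength (h + 1) • turn d b) (turn d b) l x = s at ih ⊢
    have := branchLength_pos (h + 1)
    simp only [abs_le] at ih ⊢
    rcases hd with rfl | rfl | rfl | rfl <;> cases b <;>
      simp [turn, dotp] at ih ⊢ <;> omega

/-- The two subtrees below a router lie strictly on the two sides of it. -/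
theorem portSite_cons {h : ℕ} (p : ℤ × ℤ) {d : ℤ × ℤ} (hd : IsDir d) {b : Bool} {l : List Bool}
    (hl : (b :: l).length ≤ h) (x : Option (Option Bool)) :
    if b then 2 ≤ dotp (portSite h p d (b :: l) x - p) (turn d true)
      else dotp (portSite h p d (b :: l) x - p) (turn d true) ≤ -2 := by
  obtain ⟨h, rfl⟩ : ∃ k, h = k + 1 := ⟨h - 1, by simp at hl; omega⟩
  have key := portSite_bounds (h := h) (p + branchLength (h + 1) • turn d b) (hd.turn b)
    (l := l) (by simpa using hl) x
  rw [show portSite (h + 1) p d (b :: l) x =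
    portSite h (p + branchLength (h + 1) • turn d b) (turn d b) l x from rfl]
  generalize portSite h (p + branchLength (h + 1) • turn d b) (turn d b) l x = s at key ⊢
  have := alongSpan_add_two_le h
  simp only [abs_le] at key
  rcases hd with rfl | rfl | rfl | rfl <;> cases b <;>
    simp [turn, dotp] at key ⊢ <;> omega

theorem portSite_nil (h : ℕ) (p : ℤ × ℤ) {d : ℤ × ℤ} (hd : IsDir d) (x : Option (Option Bool)) :
    |dotp (portSite h p d [] x - p) (turn d true)| ≤ 1 := by
  simp only [abs_le]
  rcases hd with rfl | rfl | rfl | rfl <;> rcases x with _ | _ | _ | _ <;>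
    simp [portSite, walk, portOffset, turn, dotp]

theorem portOffset_injective {d : ℤ × ℤ} (hd : IsDir d) : Function.Injective (portOffset d) := by
  intro x y h
  rcases hd with rfl | rfl | rfl | rfl <;> rcases x with _ | _ | _ | _ <;>
    rcases y with _ | _ | _ | _ <;> simp [portOffset, turn, Prod.ext_iff] at h ⊢

/-- The sideways coordinate relative to a router is at most -2 in its left subtree, within [-1, 1]
at the router itself and at least 2 in its right subtree, so a site determines the address bits one
after the other. -/
theorem portSite_injective {h : ℕ} {p d : ℤ × ℤ} (hd : IsDir d) {l l' : List Bool}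
    (hl : l.length ≤ h) (hl' : l'.length ≤ h) {x x' : Option (Option Bool)}
    (H : portSite h p d l x = portSite h p d l' x') : l = l' ∧ x = x' := by
  have hnil := fun x => abs_le.1 (portSite_nil h p hd x)
  induction l generalizing h p d l' with
  | nil =>
    cases l' with
    | nil => exact ⟨rfl, portOffset_injective hd (add_left_cancel H)⟩
    | cons b' l' =>
      have h1 := portSite_cons p hd hl' x'
      have h2 := hnil x
      rw [← H] at h1
      exfalso
      cases b' <;> simp at h1 <;> omega
  | cons b l ih =>
    have h1 := portSite_cons p hd hl x
    cases l' with
    | nil =>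
      have h2 := hnil x'
      rw [H] at h1
      exfalso
      cases b <;> simp at h1 <;> omega
    | cons b' l' =>
      have h2 := portSite_cons p hd hl' x'
      have hb : b = b' := by
        rw [H] at h1
        cases b <;> cases b' <;> simp at h1 h2 ⊢ <;> omega
      subst hb
      have hl0 : l.length ≤ h - 1 := by simp at hl; omega
      have hl0' : l'.length ≤ h - 1 := by simp at hl'; omega
      have := ih (h := h - 1) (p := p + branchLength h • turn d b) (hd.turn b) hl0 hl0' H
        fun x => abs_le.1 (portSite_nil _ _ (hd.turn b) x)
      simpa using this

/-! ### The layout -/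

theorem isDir_root : IsDir (0, -1) := by simp [IsDir]

theorem frame_isDir (v : Node n) : IsDir (frame v).2 := walk_isDir _ _ isDir_root _

theorem place_inp (v : Node n) :
    place (Reg.inp v) = portSite (n - 1) (0, 0) (0, -1) v.1 none := by
  simp [place, portSite, portOffset, frame]

theorem place_status (v : Node n) :
    place (Reg.status v) = portSite (n - 1) (0, 0) (0, -1) v.1 (some none) := rfl

theorem place_out (v : Node n) (b : Bool) :
    place (Reg.out v b) = portSite (n - 1) (0, 0) (0, -1) v.1 (some (some b)) := rfl

/-- The root has no register above height 0, and the subtrees stay at horizontal distance at least 2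
from the axis, so columns 0 and 1 are free above the root. -/
theorem portSite_ne_entrance {h : ℕ} {l : List Bool} (hl : l.length ≤ h)
    (x : Option (Option Bool)) {s : ℤ × ℤ} (hs : s.1 = 0 ∨ s.1 = 1) (hs' : 1 ≤ s.2) :
    portSite h (0, 0) (0, -1) l x ≠ s := by
  rintro rfl
  cases l with
  | nil =>
    rcases x with _ | _ | _ | _ <;> simp [portSite, walk, portOffset, turn] at hs hs'
  | cons b l =>
    have := portSite_cons (0, 0) isDir_root hl x
    cases b <;> simp [turn, dotp] at this <;> omega

theorem place_injective : Function.Injective (place (n := n)) := by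
  have len (v : Node n) : v.1.length ≤ n - 1 := by have := v.2; omega
  -- Every register is either a port of some router or stands at the entrance; two registers of
  -- different kinds cannot share a site.
  have port (q : Reg n) : (∃ v x, place q = portSite (n - 1) (0, 0) (0, -1) (v : Node n).1 x ∧
      q = match x with
        | none => Reg.inp v
        | some none => Reg.status v
        | some (some b) => Reg.out v b) ∨
      (((place q).1 = 0 ∨ (place q).1 = 1) ∧ 1 ≤ (place q).2 ∧
        (q = Reg.entry ∧ (place q).1 = 0 ∨ ∃ k : Ext n, q = Reg.ext k ∧ (place q).1 = 1 ∧
          (place q).2 = k + 1)) := by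
    rcases q with k | _ | v | v | ⟨v, b⟩
    · exact Or.inr ⟨Or.inr rfl, by simp [place], Or.inr ⟨k, rfl, rfl, rfl⟩⟩
    · exact Or.inr ⟨Or.inl rfl, by simp [place], Or.inl ⟨rfl, rfl⟩⟩
    · exact Or.inl ⟨v, some none, place_status v, rfl⟩
    · exact Or.inl ⟨v, none, place_inp v, rfl⟩
    · exact Or.inl ⟨v, some (some b), place_out v b, rfl⟩
  intro q q' h
  obtain ⟨v, x, hp, hq⟩ | ⟨h1, h2, hq⟩ := port q <;>
    obtain ⟨v', x', hp', hq'⟩ | ⟨h1', h2', hq'⟩ := port q'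
  · obtain ⟨hv, rfl⟩ := portSite_injective isDir_root (len v) (len v') (hp.symm.trans (h.trans hp'))
    obtain rfl := Subtype.ext hv
    exact hq.trans hq'.symm
  · exact absurd (hp.symm.trans h) (portSite_ne_entrance (len v) x h1' h2')
  · exact absurd (hp'.symm.trans h.symm) (portSite_ne_entrance (len v') x' h1 h2)
  · rw [h] at hq
    obtain ⟨rfl, h3⟩ | ⟨k, rfl, h3, h4⟩ := hq <;> obtain ⟨rfl, h3'⟩ | ⟨k', rfl, h3', h4'⟩ := hq'
    · rfl
    · omega
    · omega
    · have : k = k' := Fin.ext (by omega)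
      rw [this]

/-! ### Size of the layout and adjacency within a router -/

theorem sideSpan_sq_le (h : ℕ) : sideSpan h ^ 2 ≤ 36 * 2 ^ h := by
  have h1 := sideSpan_add_two_le h
  -- Here 36 = (2 * 3)², from the factor 3 in `branchLength` and the doubling over two levels.
  have h2 : branchLength (h + 2) ^ 2 ≤ 36 * 2 ^ h := by
    rw [branchLength_add_two, branchLength, mul_pow, mul_pow, ← pow_mul]
    have : (2 : ℤ) ^ (h / 2 * 2) ≤ 2 ^ h := pow_le_pow_right₀ (by norm_num) (by omega)
    linarith
  nlinarith [one_le_sideSpan h]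

theorem alongSpan_sq_le : ∀ h, alongSpan h ^ 2 ≤ 36 * 2 ^ h
  | 0 => by simp [alongSpan]
  | h + 1 => (sideSpan_sq_le h).trans (by rw [pow_succ]; linarith [pow_pos (two_pos (α := ℤ)) h])

theorem natAbs_sq_le {x s : ℤ} {m : ℕ} (h : |x| ≤ s) (hs : s ^ 2 ≤ m) : x.natAbs ^ 2 ≤ m := by
  zify
  exact (pow_le_pow_left₀ (abs_nonneg x) h 2).trans hs

theorem place_bounds (hn : 1 ≤ n) (q : Reg n) :
    (place q).1.natAbs ^ 2 ≤ 36 * 2 ^ n ∧ (place q).2.natAbs ^ 2 ≤ 36 * 2 ^ n := by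
  have mono : 36 * 2 ^ (n - 1) ≤ 36 * 2 ^ n :=
    Nat.mul_le_mul_left _ (Nat.pow_le_pow_right (by norm_num) (by omega))
  have port (v : Node n) (x) :
      (portSite (n - 1) (0, 0) (0, -1) v.1 x).1.natAbs ^ 2 ≤ 36 * 2 ^ n ∧
      (portSite (n - 1) (0, 0) (0, -1) v.1 x).2.natAbs ^ 2 ≤ 36 * 2 ^ n := by
    have := portSite_bounds (h := n - 1) (0, 0) isDir_root (l := v.1) (by have := v.2; omega) x
    simp only [dotp, turn, Prod.fst_sub, Prod.snd_sub, sub_zero, mul_zero, zero_add, add_zero,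
      if_true, mul_neg, mul_one, neg_neg, abs_neg] at this
    exact ⟨(natAbs_sq_le this.2 (by exact_mod_cast sideSpan_sq_le (n - 1))).trans mono,
      (natAbs_sq_le this.1 (by exact_mod_cast alongSpan_sq_le (n - 1))).trans mono⟩
  have hpow : 0 < 2 ^ n := by positivity
  rcases q with k | _ | v | v | ⟨v, b⟩
  · refine ⟨by simp [place]; omega, ?_⟩
    have hk : (k : ℕ) + 1 ≤ n + 1 := k.2
    have hsq : (n + 1) ^ 2 + 2 ≤ 36 * 2 ^ n := by
      clear hk mono port k hpow
      induction n, hn using Nat.le_induction with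
      | base => norm_num
      | succ n hn ih =>
        rw [pow_succ 2 n]
        nlinarith
    exact (Nat.pow_le_pow_left (by simp [place]; omega) 2).trans (le_of_add_le_left hsq)
  · refine ⟨by simp [place], ?_⟩
    simp [place]
    omega
  · exact port v (some none)
  · rw [place_inp]
    exact port v none
  · exact port v (some (some b))

/-- The bound is linear in N rather than in √N, by adding four coordinates of size at most 36 * 2 ^
n. Only its logarithm enters, through the duration of long-range gates. -/
theorem gridDist_le (hn : 1 ≤ n) (a b : Reg n) : gridDist a b ≤ 144 * 2 ^ n := by
  have h (x : ℤ) (hx : x.natAbs ^ 2 ≤ 36 * 2 ^ n) : x.natAbs ≤ 36 * 2 ^ n :=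
    (Nat.le_self_pow (by norm_num) _).trans hx
  have ha := place_bounds hn a
  have hb := place_bounds hn b
  have h1 := h _ ha.1
  have h2 := h _ ha.2
  have h3 := h _ hb.1
  have h4 := h _ hb.2
  unfold gridDist
  omega

theorem gridDist_inp_status (v : Node n) : gridDist (Reg.inp v) (Reg.status v) = 1 := by
  have h := frame_isDir v
  simp only [gridDist, place]
  generalize frame v = f at h ⊢
  obtain ⟨p, d⟩ := f
  rcases h with h | h | h | h <;> obtain rfl : d = _ := h <;> simp

theorem gridDist_inp_out (v : Node n) (b : Bool) : gridDist (Reg.inp v) (Reg.out v b) = 1 := by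
  have h := frame_isDir v
  simp only [gridDist, place]
  generalize frame v = f at h ⊢
  obtain ⟨p, d⟩ := f
  rcases h with h | h | h | h <;> obtain rfl : d = _ := h <;> cases b <;> simp [turn]

theorem gridDist_comm (a b : Reg n) : gridDist a b = gridDist b a := by
  unfold gridDist
  omega

/-! ### The gates of the circuit -/

/-- The shapes of the gates in a query circuit. -/
inductive Gate.IsRouting : Gate n → Prop
  | load (k : Ext n) : IsRouting (.longSwap (Reg.ext k) Reg.entry)
  | enter (v : Node n) (hv : v.1 = []) : IsRouting (.swap Reg.entry (Reg.inp v))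
  | store (v : Node n) : IsRouting (.swap (Reg.inp v) (Reg.status v))
  | route (v : Node n) (b : Bool) :
      IsRouting (.cswap b (Reg.status v) (Reg.inp v) (Reg.out v b))
  | descend (v : Node n) (b : Bool) (h : v.1.length + 1 < n) :
      IsRouting (.longSwap (Reg.out v b) (Reg.inp (v.child b h)))
  | write (v : Node n) (b d : Bool) : IsRouting (.write (Reg.out v b) d)

theorem Gate.IsRouting.involutive {g : Gate n} (hg : g.IsRouting) : Function.Involutive g.act := by
  apply Gate.IsProper.involutive
  cases hg <;> simp [Gate.IsProper]

theorem Gate.IsRouting.nearestNeighbour {g : Gate n} (hg : g.IsRouting) : g.NearestNeighbour := by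
  cases hg with
  | enter v hv => simp [Gate.NearestNeighbour, gridDist, place, frame, hv, walk]
  | store v => exact gridDist_inp_status v
  | route v b => exact ⟨(gridDist_comm _ _).trans (gridDist_inp_status v), gridDist_inp_out v b⟩
  | _ => trivial

theorem mem_routerGates {t : ℕ} {v : Node n} {k : Ext n} {g : Gate n} :
    g ∈ routerGates t v k ↔
      (v.1.length = 0 ∧ t = 4 * k.val + 1 ∧ g = .swap Reg.entry (Reg.inp v)) ∨
      (v.1.length = k.val ∧ t = 4 * k.val + 3 * v.1.length + 2 ∧
        g = .swap (Reg.inp v) (Reg.status v)) ∨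
      (v.1.length < k.val ∧ t = 4 * k.val + 3 * v.1.length + 2 ∧
        g = .cswap false (Reg.status v) (Reg.inp v) (Reg.out v false)) ∨
      (v.1.length < k.val ∧ t = 4 * k.val + 3 * v.1.length + 3 ∧
        g = .cswap true (Reg.status v) (Reg.inp v) (Reg.out v true)) ∨
      ∃ h : v.1.length + 1 < n, v.1.length < k.val ∧ t = 4 * k.val + 3 * v.1.length + 4 ∧
        ∃ b, g = .longSwap (Reg.out v b) (Reg.inp (v.child b h)) := by
  simp only [routerGates, List.mem_append, List.mem_ite_nil_right, List.mem_singleton, and_assoc,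
    or_assoc]
  refine or_congr_right (or_congr_right (or_congr_right (or_congr_right ?_)))
  by_cases h : v.1.length + 1 < n
  · simp [h, and_assoc]
  · simp [h]

theorem mem_layer {t : ℕ} {g : Gate n} :
    g ∈ layer n t ↔ (∃ k : Ext n, t = 4 * k.val ∧ g = .longSwap (Reg.ext k) Reg.entry) ∨
      ∃ v : Node n, ∃ k : Ext n, g ∈ routerGates t v k := by
  simp [layer, List.mem_flatMap]

theorem isRouting_of_mem_layer {t : ℕ} {g : Gate n} (hg : g ∈ layer n t) : g.IsRouting := by
  obtain ⟨k, -, rfl⟩ | ⟨v, k, hg⟩ := mem_layer.1 hg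
  · exact .load k
  obtain ⟨hv, -, rfl⟩ | ⟨-, -, rfl⟩ | ⟨-, -, rfl⟩ | ⟨-, -, rfl⟩ | ⟨h, -, -, b, rfl⟩ :=
    mem_routerGates.1 hg
  · exact .enter v (List.length_eq_zero_iff.1 hv)
  · exact .store v
  · exact .route v _
  · exact .route v _
  · exact .descend v b h

theorem mem_loadData {x : (Fin n → Bool) → Bool} {g : Gate n} :
    g ∈ loadData x ↔ ∃ v : Node n, v.1.length + 1 = n ∧ ∃ b,
      g = .write (Reg.out v b) (x fun m => (v.1 ++ [b]).getD m.val false) := by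
  simp only [loadData, List.mem_flatMap, Finset.mem_toList, Finset.mem_univ, true_and,
    List.mem_ite_nil_right, List.mem_map]
  refine exists_congr fun v => and_congr_right fun _ => ?_
  simp [eq_comm]

theorem isRouting_of_mem_circuit {x : (Fin n → Bool) → Bool} {L : List (Gate n)}
    (hL : L ∈ circuit x) {g : Gate n} (hg : g ∈ L) : g.IsRouting := by
  simp only [circuit, routeIn, List.mem_append, List.mem_singleton, List.mem_reverse,
    List.mem_map] at hL
  obtain (⟨t, -, rfl⟩ | rfl) | ⟨t, -, rfl⟩ := hL
  · exact isRouting_of_mem_layer hg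
  · obtain ⟨v, -, b, rfl⟩ := mem_loadData.1 hg
    exact .write v b _
  · exact isRouting_of_mem_layer hg

/-! ### Disjointness of simultaneous gates -/

/-- A necessary condition for the gates that serve qubit `k` at router `v` at time `t` to act on the
given register. -/
def Touches (t : ℕ) (v : Node n) (k : ℕ) : Reg n → Prop
  | Sum.inl _ => False
  | Sum.inr .entry => v.1.length = 0 ∧ t = 4 * k + 1
  | Sum.inr (.status w) => w = v
  | Sum.inr (.out w _) => w = v
  | Sum.inr (.inp w) => (w = v ∧ (v.1.length = 0 ∧ t = 4 * k + 1 ∨ t = 4 * k + 3 * v.1.length + 2 ∨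
      t = 4 * k + 3 * v.1.length + 3)) ∨ ∃ b, w.1 = v.1 ++ [b] ∧ t = 4 * k + 3 * v.1.length + 4

theorem touches_of_mem {t : ℕ} {v : Node n} {k : Ext n} {g : Gate n} (hg : g ∈ routerGates t v k)
    {q : Reg n} (hq : q ∈ g.support) : Touches t v k q := by
  obtain ⟨h, h', rfl⟩ | ⟨-, h, rfl⟩ | ⟨-, h, rfl⟩ | ⟨-, h, rfl⟩ | ⟨h', -, h, b, rfl⟩ :=
    mem_routerGates.1 hg
  all_goals simp only [Gate.support, Finset.mem_insert, Finset.mem_singleton] at hq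
  · obtain rfl | rfl := hq <;> simp [Touches, h, h']
  · obtain rfl | rfl := hq <;> simp [Touches, h]
  · obtain rfl | rfl | rfl := hq <;> simp [Touches, h]
  · obtain rfl | rfl | rfl := hq <;> simp [Touches, h]
  · obtain rfl | rfl := hq <;> simp [Touches, h, Node.child]

/-- At a given router the four-step windows of different qubits are disjoint, so at most one qubit
is served at a time. -/
theorem time_of_mem {t : ℕ} {v : Node n} {k : Ext n} {g : Gate n} (hg : g ∈ routerGates t v k) :
    4 * k.val + 3 * v.1.length + 1 ≤ t ∧ t ≤ 4 * k.val + 3 * v.1.length + 4 := by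
  obtain ⟨h, h', -⟩ | ⟨-, h, -⟩ | ⟨-, h, -⟩ | ⟨-, h, -⟩ | ⟨-, -, h, -⟩ := mem_routerGates.1 hg <;>
    omega

/-- Only an incident register can be used by two routers, its own and its parent. With ℓ its depth,
the parent acts at times congruent to 3ℓ + 1 modulo 4 and the router itself at 3ℓ + 2 or 3ℓ + 3; the
additional use at the root is harmless because the root has no parent. -/
theorem Touches.unique {t : ℕ} {v v' : Node n} {k k' : ℕ} {q : Reg n} (h : Touches t v k q)
    (h' : Touches t v' k' q) : v = v' := by
  rcases q with _ | _ | w | w | ⟨w, b⟩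
  · exact h.elim
  · exact Subtype.ext ((List.length_eq_zero_iff.1 h.1).trans (List.length_eq_zero_iff.1 h'.1).symm)
  · exact h.symm.trans h'
  · obtain ⟨rfl, h⟩ | ⟨b, hb, h⟩ := h <;> obtain ⟨rfl, h'⟩ | ⟨b', hb', h'⟩ := h'
    · rfl
    · have := congrArg List.length hb'
      simp only [List.length_append, List.length_singleton] at this
      omega
    · have := congrArg List.length hb
      simp only [List.length_append, List.length_singleton] at this
      omega
    · exact Subtype.ext (List.append_inj_left' (hb.symm.trans hb') rfl)
  · exact h.symm.trans h'

theorem pairwise_routerGates (t : ℕ) (v : Node n) (k : Ext n) :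
    (routerGates t v k).Pairwise fun g g' => Disjoint g.support g'.support := by
  simp only [routerGates]
  split_ifs <;> first
    | (exfalso; omega)
    | simp [Gate.support, Node.child]

theorem pairwise_layer (n t : ℕ) :
    (layer n t).Pairwise fun g g' => Disjoint g.support g'.support := by
  rw [layer, List.pairwise_append]
  refine ⟨?_, ?_, ?_⟩
  · rw [List.pairwise_flatMap]
    refine ⟨fun k _ => by split_ifs <;> simp, (List.nodup_finRange _).imp fun {k k'} hk => ?_⟩
    intro g hg g' hg'
    simp only [List.mem_ite_nil_right] at hg hg'
    exact absurd (Fin.ext (by omega)) hk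
  · rw [List.pairwise_flatMap]
    refine ⟨fun v _ => ?_, (Finset.nodup_toList _).imp fun {v v'} hv => ?_⟩
    · rw [List.pairwise_flatMap]
      refine ⟨fun k _ => pairwise_routerGates t v k,
        (List.nodup_finRange _).imp fun {k k'} hk => ?_⟩
      intro g hg g' hg'
      have h := time_of_mem hg
      have h' := time_of_mem hg'
      exact absurd (Fin.ext (by omega)) hk
    · intro g hg g' hg'
      obtain ⟨k, -, hg⟩ := List.mem_flatMap.1 hg
      obtain ⟨k', -, hg'⟩ := List.mem_flatMap.1 hg'
      exact Finset.disjoint_left.2 fun q hq hq' =>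
        hv ((touches_of_mem hg hq).unique (touches_of_mem hg' hq'))
  · intro g hg g' hg'
    obtain ⟨k, -, hg⟩ := List.mem_flatMap.1 hg
    obtain ⟨v, -, hg'⟩ := List.mem_flatMap.1 hg'
    obtain ⟨k', -, hg'⟩ := List.mem_flatMap.1 hg'
    obtain ⟨ht, hg⟩ := List.mem_ite_nil_right.1 hg
    obtain rfl := List.mem_singleton.1 hg
    refine Finset.disjoint_left.2 fun q hq hq' => ?_
    have h := touches_of_mem hg' hq'
    simp only [Gate.support, Finset.mem_insert, Finset.mem_singleton] at hq
    obtain rfl | rfl := hq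
    · exact h
    · have := h.2
      omega

theorem pairwise_loadData (x : (Fin n → Bool) → Bool) :
    (loadData x).Pairwise fun g g' => Disjoint g.support g'.support := by
  rw [loadData, List.pairwise_flatMap]
  refine ⟨fun v _ => ?_, (Finset.nodup_toList _).imp fun {v v'} hv => ?_⟩
  · split_ifs <;> simp [Gate.support]
  · intro g hg g' hg'
    simp only [List.mem_ite_nil_right, List.mem_map] at hg hg'
    obtain ⟨-, b, -, rfl⟩ := hg
    obtain ⟨-, b', -, rfl⟩ := hg'
    simp [Gate.support, hv]

theorem isPlanarLocal (x : (Fin n → Bool) → Bool) : IsPlanarLocal x := by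
  refine ⟨place_injective, fun L hL =>
    ⟨fun g hg => (isRouting_of_mem_circuit hL hg).nearestNeighbour, ?_⟩⟩
  simp only [circuit, routeIn, List.mem_append, List.mem_singleton, List.mem_reverse,
    List.mem_map] at hL
  obtain (⟨t, -, rfl⟩ | rfl) | ⟨t, -, rfl⟩ := hL
  · exact pairwise_layer n t
  · exact pairwise_loadData x
  · exact pairwise_layer n t

/-! ### Layers of disjoint gates -/

theorem runGates_cons (g : Gate n) (L : List (Gate n)) (c : Config n) :
    runGates (g :: L) c = runGates L (g.act c) := rfl

theorem runGates_append (L L' : List (Gate n)) (c : Config n) :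
    runGates (L ++ L') c = runGates L' (runGates L c) := List.foldl_append

theorem runGates_of_notMem {L : List (Gate n)} {q : Reg n} (h : ∀ g ∈ L, q ∉ g.support)
    (c : Config n) : runGates L c q = c q := by
  induction L generalizing c with
  | nil => rfl
  | cons g L ih =>
    rw [runGates_cons, ih fun g' hg' => h g' (List.mem_cons_of_mem _ hg'),
      Gate.act_of_notMem (h g List.mem_cons_self)]

theorem runGates_of_mem {L : List (Gate n)}
    (hL : L.Pairwise fun g g' => Disjoint g.support g'.support) {g : Gate n} (hg : g ∈ L)
    {q : Reg n} (hq : q ∈ g.support) (c : Config n) : runGates L c q = g.act c q := by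
  induction L generalizing c with
  | nil => cases hg
  | cons g' L ih =>
    obtain ⟨h, hL⟩ := List.pairwise_cons.1 hL
    rw [runGates_cons]
    obtain rfl | hg := List.mem_cons.1 hg
    · exact runGates_of_notMem (fun g'' hg'' => Finset.disjoint_left.1 (h g'' hg'') hq) _
    · rw [ih hL hg]
      exact Gate.act_congr
        (fun r hr => Gate.act_of_notMem (Finset.disjoint_right.1 (h g hg) hr) c) hq

theorem runGates_eq {L : List (Gate n)}
    (hL : L.Pairwise fun g g' => Disjoint g.support g'.support) {c c' : Config n}
    (h : ∀ g ∈ L, ∀ q ∈ g.support, g.act c q = c' q)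
    (h' : ∀ q, (∀ g ∈ L, q ∉ g.support) → c q = c' q) : runGates L c = c' := by
  ext q : 1
  by_cases hq : ∀ g ∈ L, q ∉ g.support
  · rw [runGates_of_notMem hq, h' q hq]
  · push Not at hq
    obtain ⟨g, hg, hq⟩ := hq
    rw [runGates_of_mem hL hg hq, h g hg q hq]

/-- Gates on disjoint supports commute, so repeating a layer in the same order undoes it. This is
why the reversed circuit reverses the list of layers but not the gates in a layer. -/
theorem runGates_runGates {L : List (Gate n)}
    (hL : L.Pairwise fun g g' => Disjoint g.support g'.support)
    (hinv : ∀ g ∈ L, Function.Involutive g.act) (c : Config n) :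
    runGates L (runGates L c) = c := by
  refine runGates_eq hL (fun g hg q hq => ?_) fun q hq => runGates_of_notMem hq c
  rw [Gate.act_congr (fun r hr => runGates_of_mem hL hg hr c) hq, hinv g hg]

/-! ### The registers on the path of an address -/

/-- The register lies on the path to the memory cell `a`. -/
def OnPath (a : Fin n → Bool) : Reg n → Prop
  | Sum.inl _ => True
  | Sum.inr .entry => True
  | Sum.inr (.status v) => v.1 <+: List.ofFn a
  | Sum.inr (.inp v) => v.1 <+: List.ofFn a
  | Sum.inr (.out v b) => v.1 ++ [b] <+: List.ofFn a

open scoped Classical in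
/-- The registers on the paths to the memory cells in `s`. -/
def pathRegs (s : Finset (Fin n → Bool)) : Finset (Reg n) :=
  Finset.univ.filter fun q => ∃ a ∈ s, OnPath a q

theorem mem_pathRegs {s : Finset (Fin n → Bool)} {q : Reg n} :
    q ∈ pathRegs s ↔ ∃ a ∈ s, OnPath a q := by simp [pathRegs]

theorem prefix_of_concat_prefix {l p : List Bool} {b : Bool} (h : l ++ [b] <+: p) : l <+: p :=
  (List.prefix_append l [b]).trans h

/-- Every active router status on the way to the cell `a` points towards `a`. -/
def StatusGood (a : Fin n → Bool) (c : Config n) : Prop :=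
  ∀ v b, c (Reg.status v) = some b → v.1 ++ [b] <+: List.ofFn a

/-- Except for CSWAPs, all registers of a gate lie on the same paths: in particular, an output and
the incident register of the child behind it. A CSWAP can straddle the boundary only at the output
that no address of `s` takes, and there the status of the branch `a` points the other way or is
inactive. -/
theorem Gate.IsRouting.respects {g : Gate n} (hg : g.IsRouting) {s : Finset (Fin n → Bool)}
    {a : Fin n → Bool} (ha : a ∈ s) {c : Config n} (hc : StatusGood a c) :
    g.Respects (pathRegs s) c := by
  have both {P : Prop} (h : ∀ q ∈ g.support, q ∈ pathRegs s ↔ P) : g.Respects (pathRegs s) c := by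
    by_cases hP : P
    · exact Or.inr (Or.inl fun q hq => (h q hq).2 hP)
    · exact Or.inl (Finset.disjoint_left.2 fun q hq hq' => hP ((h q hq).1 hq'))
  cases hg with
  | load k =>
    refine both (P := True) fun q hq => ?_
    simp only [Gate.support, Finset.mem_insert, Finset.mem_singleton] at hq
    obtain rfl | rfl := hq <;> simpa [mem_pathRegs, OnPath] using ⟨a, ha⟩
  | enter v hv =>
    refine both (P := True) fun q hq => ?_
    simp only [Gate.support, Finset.mem_insert, Finset.mem_singleton] at hq
    obtain rfl | rfl := hq <;> simpa [mem_pathRegs, OnPath, hv] using ⟨a, ha⟩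
  | store v =>
    refine both (P := ∃ a ∈ s, v.1 <+: List.ofFn a) fun q hq => ?_
    simp only [Gate.support, Finset.mem_insert, Finset.mem_singleton] at hq
    obtain rfl | rfl := hq <;> simp [mem_pathRegs, OnPath]
  | descend v b h =>
    refine both (P := ∃ a ∈ s, v.1 ++ [b] <+: List.ofFn a) fun q hq => ?_
    simp only [Gate.support, Finset.mem_insert, Finset.mem_singleton] at hq
    obtain rfl | rfl := hq <;> simp [mem_pathRegs, OnPath, Node.child]
  | write v b d =>
    refine both (P := ∃ a ∈ s, v.1 ++ [b] <+: List.ofFn a) fun q hq => ?_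
    simp only [Gate.support, Finset.mem_singleton] at hq
    obtain rfl := hq
    simp [mem_pathRegs, OnPath]
  | route v b =>
    by_cases hb : ∃ a ∈ s, v.1 ++ [b] <+: List.ofFn a
    · obtain ⟨a', ha', hb⟩ := hb
      refine Or.inr (Or.inl fun q hq => mem_pathRegs.2 ⟨a', ha', ?_⟩)
      simp only [Gate.support, Finset.mem_insert, Finset.mem_singleton] at hq
      obtain rfl | rfl | rfl := hq
      · exact prefix_of_concat_prefix hb
      · exact prefix_of_concat_prefix hb
      · exact hb
    by_cases hv : ∃ a ∈ s, v.1 <+: List.ofFn a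
    · exact Or.inr (Or.inr ⟨b, _, _, _, rfl, mem_pathRegs.2 hv, fun h => hb ⟨a, ha, hc v b h⟩⟩)
    · refine Or.inl (Finset.disjoint_left.2 fun q hq hq' => ?_)
      obtain ⟨a', ha', h⟩ := mem_pathRegs.1 hq'
      simp only [Gate.support, Finset.mem_insert, Finset.mem_singleton] at hq
      obtain rfl | rfl | rfl := hq
      · exact hv ⟨a', ha', h⟩
      · exact hv ⟨a', ha', h⟩
      · exact hb ⟨a', ha', h⟩

theorem respectAll_append {K : Finset (Reg n)} {L L' : List (Gate n)} {c : Config n}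
    (h : RespectAll K L c) (h' : RespectAll K L' (runGates L c)) : RespectAll K (L ++ L') c := by
  induction L generalizing c with
  | nil => exact h'
  | cons g L ih => exact ⟨h.1, ih h.2 h'⟩

/-- In a layer each status register is touched by at most one gate, so at any moment inside the
layer it has its value from before or after the layer. Control of these two states therefore
suffices. -/
theorem respectAll_of_statusGood {L : List (Gate n)}
    (hL : L.Pairwise fun g g' => Disjoint g.support g'.support) (hL' : ∀ g ∈ L, g.IsRouting)
    {s : Finset (Fin n → Bool)} {a : Fin n → Bool} (ha : a ∈ s) {c : Config n}
    (hc : StatusGood a c) (hc' : StatusGood a (runGates L c)) : RespectAll (pathRegs s) L c := by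
  induction L generalizing c with
  | nil => trivial
  | cons g L ih =>
    obtain ⟨h, hL⟩ := List.pairwise_cons.1 hL
    refine ⟨(hL' g List.mem_cons_self).respects ha hc,
      ih hL (fun g' hg' => hL' g' (List.mem_cons_of_mem _ hg')) (fun v b hv => ?_) hc'⟩
    by_cases hq : Reg.status v ∈ g.support
    · refine hc' v b ?_
      rw [runGates_cons,
        runGates_of_notMem fun g' hg' => Finset.disjoint_left.1 (h g' hg') hq, hv]
    · exact hc v b (by rw [← hv, Gate.act_of_notMem hq])

/-! ### The ideal query on a basis state -/

/-- The value of the address qubit number `k < n`, or of the bus if `k = n`. -/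
def content (a : Fin n → Bool) (b : Bool) (k : ℕ) : Level :=
  if h : k < n + 1 then extBasis a b ⟨k, h⟩ else none

theorem content_of_lt {a : Fin n → Bool} {b : Bool} {k : ℕ} (h : k < n) :
    content a b k = some (a ⟨k, h⟩) := by
  rw [content, dif_pos (by omega)]
  exact Fin.snoc_castSucc (α := fun _ => Level) _ _ (⟨k, h⟩ : Fin n)

theorem content_self (a : Fin n → Bool) (b : Bool) : content a b n = some b := by
  rw [content, dif_pos (by omega)]
  exact Fin.snoc_last (α := fun _ => Level) _ _

theorem content_fin (a : Fin n → Bool) (b : Bool) (k : Ext n) :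
    content a b k = extBasis a b k := dif_pos k.2

/-- Slots of the pipeline behind the bus are empty. With this convention the formulas for the ideal
state need no upper bound on the qubit number. -/
theorem content_eq_none {a : Fin n → Bool} {b : Bool} {k : ℕ} (h : n < k) :
    content a b k = none := dif_neg (by omega)

theorem concat_prefix_iff {a : Fin n → Bool} {v : Node n} {b : Bool} :
    v.1 ++ [b] <+: List.ofFn a ↔ v.1 <+: List.ofFn a ∧ a ⟨v.1.length, v.2⟩ = b := by
  have h := v.2
  constructor
  · intro hp
    refine ⟨prefix_of_concat_prefix hp, ?_⟩
    have := List.IsPrefix.getElem hp (i := v.1.length) (by simp)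
    simpa using this.symm
  · rintro ⟨hp, rfl⟩
    rw [List.prefix_iff_eq_take] at hp ⊢
    rw [List.length_append, List.length_singleton, List.take_add_one, ← hp]
    simp [h]

theorem content_status {a : Fin n → Bool} {b d : Bool} {v : Node n} (hv : v.1 <+: List.ofFn a) :
    content a b v.1.length = some d ↔ v.1 ++ [d] <+: List.ofFn a := by
  rw [content_of_lt v.2, concat_prefix_iff, Option.some_inj, and_iff_right hv]

open scoped Classical in
/-- The basis state of the memory before layer `t` of the route-in phase for the address `a`, with
the bus in state `b`. -/
def idealState (a : Fin n → Bool) (b : Bool) (t : ℕ) : Config n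
  | Sum.inl k => if t ≤ 4 * k then content a b k else none
  | Sum.inr .entry => if t % 4 = 1 then content a b (t / 4) else none
  | Sum.inr (.status v) =>
    if v.1 <+: List.ofFn a ∧ 7 * v.1.length + 3 ≤ t then content a b v.1.length else none
  | Sum.inr (.inp v) =>
    -- Qubit k arrives so as to be present at time 4k + 3ℓ + 2; the quotient by 4 recovers k and the
    -- remainder the phase of its visit. The first conjunct guards the truncated subtraction.
    if 3 * v.1.length + 2 ≤ t ∧ v.1 <+: List.ofFn a ∧
        ((t - (3 * v.1.length + 2)) % 4 = 0 ∧ v.1.length ≤ (t - (3 * v.1.length + 2)) / 4 ∨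
          (t - (3 * v.1.length + 2)) % 4 = 1 ∧ v.1.length < (t - (3 * v.1.length + 2)) / 4 ∧
            v.1 ++ [true] <+: List.ofFn a)
    then content a b ((t - (3 * v.1.length + 2)) / 4) else none
  | Sum.inr (.out v d) =>
    if 3 * v.1.length + 2 ≤ t ∧ v.1 ++ [d] <+: List.ofFn a ∧
        v.1.length < (t - (3 * v.1.length + 2)) / 4 ∧
        ((t - (3 * v.1.length + 2)) % 4 = 1 ∧ d = false ∨ (t - (3 * v.1.length + 2)) % 4 = 2)
    then content a b ((t - (3 * v.1.length + 2)) / 4) else none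

theorem statusGood_idealState (a : Fin n → Bool) (b : Bool) (t : ℕ) :
    StatusGood a (idealState a b t) := by
  intro v d h
  simp only [idealState] at h
  split_ifs at h with h'
  exact (content_status h'.1).1 h

section
open scoped Classical
variable (a : Fin n → Bool) (b : Bool)

/-- In phase 0 the qubit has arrived. In phase 1 it is still here only if it turns right, since a
left turn is made first. Afterwards the register is empty. -/
theorem idealState_inp (v : Node n) (k : ℕ) {t r : ℕ} (ht : t = 4 * k + 3 * v.1.length + 2 + r)
    (hr : r < 4) : idealState a b t (Reg.inp v) = if v.1 <+: List.ofFn a ∧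
      (r = 0 ∧ v.1.length ≤ k ∨ r = 1 ∧ v.1.length < k ∧ v.1 ++ [true] <+: List.ofFn a)
      then content a b k else none := by
  have h1 : (t - (3 * v.1.length + 2)) / 4 = k := by omega
  have h2 : (t - (3 * v.1.length + 2)) % 4 = r := by omega
  have h3 : 3 * v.1.length + 2 ≤ t := by omega
  simp only [idealState, h1, h2, h3, true_and]

/-- A left-turning qubit occupies its output in phases 1 and 2, a right-turning one in phase 2 only.
-/
theorem idealState_out (v : Node n) (d : Bool) (k : ℕ) {t r : ℕ}
    (ht : t = 4 * k + 3 * v.1.length + 2 + r) (hr : r < 4) :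
    idealState a b t (Reg.out v d) = if v.1 ++ [d] <+: List.ofFn a ∧ v.1.length < k ∧
      (r = 1 ∧ d = false ∨ r = 2) then content a b k else none := by
  have h1 : (t - (3 * v.1.length + 2)) / 4 = k := by omega
  have h2 : (t - (3 * v.1.length + 2)) % 4 = r := by omega
  have h3 : 3 * v.1.length + 2 ≤ t := by omega
  simp only [idealState, h1, h2, h3, true_and]

theorem idealState_inp_of_lt (v : Node n) {t : ℕ} (ht : t < 3 * v.1.length + 2) :
    idealState a b t (Reg.inp v) = none :=
  if_neg fun h => by omega

theorem idealState_out_of_lt (v : Node n) (d : Bool) {t : ℕ} (ht : t < 3 * v.1.length + 2) :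
    idealState a b t (Reg.out v d) = none :=
  if_neg fun h => by omega

end

/-! ### One layer of the ideal evolution -/

theorem swap_act {x y : Reg n} {c c' : Config n} (h : c x = c' y) (h' : c y = c' x) :
    ∀ q ∈ (Gate.swap x y).support, (Gate.swap x y).act c q = c' q := by
  intro q hq
  simp only [Gate.support, Finset.mem_insert, Finset.mem_singleton] at hq
  obtain rfl | rfl := hq
  · simpa [Gate.act] using h'
  · simpa [Gate.act] using h

theorem longSwap_act {x y : Reg n} {c c' : Config n} (h : c x = c' y) (h' : c y = c' x) :
    ∀ q ∈ (Gate.longSwap x y).support, (Gate.longSwap x y).act c q = c' q := swap_act h h'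

theorem cswap_act {d : Bool} {s x y : Reg n} (hs : s ≠ x ∧ s ≠ y) {c c' : Config n}
    (h : c' s = c s) (h₁ : c s = some d → c x = c' y ∧ c y = c' x)
    (h₂ : c s ≠ some d → c x = c' x ∧ c y = c' y) :
    ∀ q ∈ (Gate.cswap d s x y).support, (Gate.cswap d s x y).act c q = c' q := by
  intro q hq
  simp only [Gate.support, Finset.mem_insert, Finset.mem_singleton] at hq
  simp only [Gate.act]
  split_ifs with hd
  · obtain rfl | hq := hq
    · simp [Equiv.swap_apply_of_ne_of_ne hs.1 hs.2, h]
    · exact swap_act (h₁ hd).1 (h₁ hd).2 q (by simpa [Gate.support] using hq)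
  · obtain rfl | rfl | rfl := hq
    · exact h.symm
    · exact (h₂ hd).1
    · exact (h₂ hd).2

theorem prefix_iff_or {a : Fin n → Bool} {v : Node n} : v.1 <+: List.ofFn a ↔
    v.1 ++ [false] <+: List.ofFn a ∨ v.1 ++ [true] <+: List.ofFn a := by
  simp only [concat_prefix_iff]
  cases a ⟨v.1.length, v.2⟩ <;> simp

theorem not_both_prefix {a : Fin n → Bool} {v : Node n} (h : v.1 ++ [false] <+: List.ofFn a) :
    ¬ v.1 ++ [true] <+: List.ofFn a := by
  simp only [concat_prefix_iff] at h ⊢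
  simp [h.2]

theorem idealState_status (a : Fin n → Bool) (b : Bool) {v : Node n} {t : ℕ}
    (ht : 7 * v.1.length + 3 ≤ t) (d : Bool) :
    idealState a b t (Reg.status v) = some d ↔ v.1 ++ [d] <+: List.ofFn a := by
  simp only [idealState, ht, and_true]
  split_ifs with h
  · exact content_status h
  · simpa using fun h' => h (prefix_of_concat_prefix h')

/-- Since the gates of a layer are disjoint, the closed formula can be verified one gate at a time,
in the phase of the visit at which that gate acts. -/
theorem act_idealState (a : Fin n → Bool) (b : Bool) {t : ℕ} {g : Gate n} (hg : g ∈ layer n t) :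
    ∀ q ∈ g.support, g.act (idealState a b t) q = idealState a b (t + 1) q := by
  obtain ⟨k, ht, rfl⟩ | ⟨v, k, hg⟩ := mem_layer.1 hg
  · have h1 : (t + 1) / 4 = k.val := by omega
    refine longSwap_act ?_ ?_
    · simp only [idealState, h1]
      rw [if_pos (by omega), if_pos (by omega)]
    · simp only [idealState]
      rw [if_neg (by omega), if_neg (by omega)]
  -- Qubit ℓ becomes the status at depth ℓ in layer 7ℓ + 2, before any later qubit is routed there.
  have status (h : v.1.length < k.val) (ht : 4 * k.val + 3 * v.1.length + 2 ≤ t) :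
      idealState a b (t + 1) (Reg.status v) = idealState a b t (Reg.status v) := by
    simp only [idealState]
    simp only [show 7 * v.1.length + 3 ≤ t by omega, show 7 * v.1.length + 3 ≤ t + 1 by omega]
  obtain ⟨hv, ht, rfl⟩ | ⟨hv, ht, rfl⟩ | ⟨hv, ht, rfl⟩ | ⟨hv, ht, rfl⟩ | ⟨h, hv, ht, d, rfl⟩ :=
    mem_routerGates.1 hg
  · refine swap_act ?_ ?_
    · rw [idealState_inp a b v k (r := 0) (by omega) (by omega)]
      have h1 : t / 4 = k.val := by omega
      simp only [idealState, h1]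
      rw [if_pos (by omega), if_pos]
      simp [List.length_eq_zero_iff.1 hv]
    · have h1 : idealState a b (t + 1) Reg.entry = none := if_neg (by omega)
      rw [h1]
      by_cases hk : k.val = 0
      · exact idealState_inp_of_lt a b v (by omega)
      -- The arrival of qubit k falls into phase 3 of the visit of qubit k - 1, when the incident
      -- register is already empty.
      · rw [idealState_inp a b v (k - 1) (r := 3) (by omega) (by omega), if_neg (by simp)]
  · refine swap_act ?_ ?_
    · rw [idealState_inp a b v k (r := 0) (by omega) (by omega)]
      simp only [idealState]
      simp [hv, show 7 * k.val + 3 ≤ t + 1 by omega]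
    · rw [idealState_inp a b v k (r := 1) (by omega) (by omega)]
      simp only [idealState]
      rw [if_neg (by omega), if_neg (by omega)]
  · have h0 := idealState_inp a b v k (t := t) (r := 0) (by omega) (by omega)
    have h1 := idealState_inp a b v k (t := t + 1) (r := 1) (by omega) (by omega)
    have h2 := idealState_out a b v false k (t := t) (r := 0) (by omega) (by omega)
    have h3 := idealState_out a b v false k (t := t + 1) (r := 1) (by omega) (by omega)
    have hs := idealState_status a b (v := v) (t := t) (by omega) false
    refine cswap_act (by simp) (status hv (by omega)) (fun h => ?_) (fun h => ?_)
    · have h := hs.1 h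
      rw [h0, h1, h2, h3]
      simp [h, hv, hv.le, not_both_prefix h, prefix_iff_or]
    · have h := mt hs.2 h
      rw [h0, h1, h2, h3]
      simp [h, hv, hv.le, prefix_iff_or]
  · have h0 := idealState_inp a b v k (t := t) (r := 1) (by omega) (by omega)
    have h1 := idealState_inp a b v k (t := t + 1) (r := 2) (by omega) (by omega)
    have h2 := idealState_out a b v true k (t := t) (r := 1) (by omega) (by omega)
    have h3 := idealState_out a b v true k (t := t + 1) (r := 2) (by omega) (by omega)
    have hs := idealState_status a b (v := v) (t := t) (by omega) true
    refine cswap_act (by simp) (status hv (by omega)) (fun h => ?_) (fun h => ?_)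
    · have h := hs.1 h
      rw [h0, h1, h2, h3]
      simp [h, hv, prefix_iff_or]
    · have h := mt hs.2 h
      rw [h0, h1, h2, h3]
      simp [h]
  · refine longSwap_act ?_ ?_
    · rw [idealState_inp a b _ k (r := 0) (by simp [Node.child]; omega) (by omega),
        idealState_out a b v _ k (r := 2) (by omega) (by omega)]
      simp only [Node.child, List.length_append, List.length_singleton]
      simp [hv, Nat.succ_le_of_lt hv]
    · rw [idealState_inp a b _ (k - 1) (r := 3) (by simp [Node.child]; omega) (by omega),
        idealState_out a b v _ k (r := 3) (by omega) (by omega)]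
      simp

theorem idealState_of_untouched (a : Fin n → Bool) (b : Bool) {t : ℕ} (ht : t ≤ 7 * n) {q : Reg n}
    (hq : ∀ g ∈ layer n t, q ∉ g.support) : idealState a b t q = idealState a b (t + 1) q := by
  have free (v : Node n) (k : Ext n) {g : Gate n} (hg : q ∈ g.support) : g ∉ routerGates t v k :=
    fun h => hq g (mem_layer.2 (Or.inr ⟨v, k, h⟩)) hg
  rcases q with k | _ | v | v | ⟨v, d⟩
  · have h : t ≠ 4 * k.val := fun h =>
      hq _ (mem_layer.2 (Or.inl ⟨k, h, rfl⟩)) (by simp [Gate.support])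
    simp only [idealState]
    simp only [show t ≤ 4 * k.val ↔ t + 1 ≤ 4 * k.val by omega]
  · have h (k : Ext n) : t ≠ 4 * k.val := fun h =>
      hq _ (mem_layer.2 (Or.inl ⟨k, h, rfl⟩)) (by simp [Gate.support])
    have h' (k : Ext n) : t ≠ 4 * k.val + 1 := fun h => by
      by_cases hn : 0 < n
      · exact free (Node.root hn) k (g := .swap Reg.entry (Reg.inp (Node.root hn)))
          (by simp [Gate.support]) (mem_routerGates.2 (Or.inl ⟨rfl, h, rfl⟩))
      · omega
    simp only [idealState]
    have h1 (h4 : t % 4 = 1) : content a b (t / 4) = none := content_eq_none (by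
      by_contra hk
      exact h' ⟨t / 4, by omega⟩ (by simp only; omega))
    have h2 (h4 : (t + 1) % 4 = 1) : content a b ((t + 1) / 4) = none := content_eq_none (by
      by_contra hk
      exact h ⟨(t + 1) / 4, by omega⟩ (by simp only; omega))
    split_ifs with h3 h4 h4
    · omega
    · exact h1 h3
    · exact (h2 h4).symm
    · rfl
  · have h : t ≠ 7 * v.1.length + 2 := fun h =>
      free v ⟨v.1.length, by have := v.2; omega⟩ (g := .swap (Reg.inp v) (Reg.status v))
        (by simp [Gate.support]) (mem_routerGates.2 (Or.inr (Or.inl ⟨rfl, by simp only; omega, rfl⟩)))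
    simp only [idealState]
    simp only [show 7 * v.1.length + 3 ≤ t ↔ 7 * v.1.length + 3 ≤ t + 1 by omega]
  · have store (k : Ext n) (hk : v.1.length = k) : t ≠ 4 * k.val + 3 * v.1.length + 2 := fun h =>
      free v k (g := .swap (Reg.inp v) (Reg.status v)) (by simp [Gate.support])
        (mem_routerGates.2 (Or.inr (Or.inl ⟨hk, h, rfl⟩)))
    have left (k : Ext n) (hk : v.1.length < k) : t ≠ 4 * k.val + 3 * v.1.length + 2 := fun h =>
      free v k (g := .cswap false (Reg.status v) (Reg.inp v) (Reg.out v false))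
        (by simp [Gate.support])
        (mem_routerGates.2 (Or.inr (Or.inr (Or.inl ⟨hk, h, rfl⟩))))
    have right (k : Ext n) (hk : v.1.length < k) : t ≠ 4 * k.val + 3 * v.1.length + 3 := fun h =>
      free v k (g := .cswap true (Reg.status v) (Reg.inp v) (Reg.out v true))
        (by simp [Gate.support])
        (mem_routerGates.2 (Or.inr (Or.inr (Or.inr (Or.inl ⟨hk, h, rfl⟩)))))
    have arrive (k : Ext n) (hk : v.1.length ≤ k) : t ≠ 4 * k.val + 3 * v.1.length + 1 := fun h => by
      obtain hv | ⟨l, d, hv⟩ := List.eq_nil_or_concat' v.1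
      · exact free v k (g := .swap Reg.entry (Reg.inp v)) (by simp [Gate.support])
          (mem_routerGates.2 (Or.inl ⟨by simp [hv], by simpa [hv] using h, rfl⟩))
      · have hl := v.2
        have hlen : v.1.length = l.length + 1 := by simp [hv]
        refine free ⟨l, by omega⟩ k (g := .longSwap (Reg.out ⟨l, by omega⟩ d) (Reg.inp v))
          (by simp [Gate.support]) (mem_routerGates.2 (Or.inr (Or.inr (Or.inr (Or.inr
            ⟨by simp only; omega, by simp only; omega, by simp only; omega, d, ?_⟩)))))
        congr
        exact Subtype.ext hv
    -- An incident register is occupied only just before or just after a gate that acts on it. If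
    -- layer `t` leaves it alone, it is empty at both times.
    have none_at (s : ℕ) (hs : s = t ∨ s = t + 1) : idealState a b s (Reg.inp v) = none := by
      by_cases h : s < 3 * v.1.length + 2
      · exact idealState_inp_of_lt a b v h
      obtain ⟨k, r, hr, rfl⟩ : ∃ k r, r < 4 ∧ s = 4 * k + 3 * v.1.length + 2 + r :=
        ⟨(s - (3 * v.1.length + 2)) / 4, (s - (3 * v.1.length + 2)) % 4, by omega, by omega⟩
      rw [idealState_inp a b v k rfl hr, ite_eq_right_iff]
      rintro ⟨-, h⟩
      refine content_eq_none ?_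
      by_contra hk
      have h1 := store ⟨k, by omega⟩
      have h2 := left ⟨k, by omega⟩
      have h3 := right ⟨k, by omega⟩
      have h4 := arrive ⟨k, by omega⟩
      simp only at h1 h2 h3 h4
      omega
    rw [none_at t (Or.inl rfl), none_at (t + 1) (Or.inr rfl)]
  · have route (k : Ext n) (hk : v.1.length < k) :
        t ≠ 4 * k.val + 3 * v.1.length + 2 + d.toNat := fun h => by
      cases d
      · exact free v k (g := .cswap false (Reg.status v) (Reg.inp v) (Reg.out v false))
          (by simp [Gate.support])
          (mem_routerGates.2 (Or.inr (Or.inr (Or.inl ⟨hk, h, rfl⟩))))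
      · exact free v k (g := .cswap true (Reg.status v) (Reg.inp v) (Reg.out v true))
          (by simp [Gate.support])
          (mem_routerGates.2 (Or.inr (Or.inr (Or.inr (Or.inl ⟨hk, h, rfl⟩)))))
    have leave (k : Ext n) (hk : v.1.length < k) : t ≠ 4 * k.val + 3 * v.1.length + 4 := fun h => by
      have := v.2
      by_cases hn : v.1.length + 1 < n
      · exact free v k (g := .longSwap (Reg.out v d) (Reg.inp (v.child d hn)))
          (by simp [Gate.support])
          (mem_routerGates.2 (Or.inr (Or.inr (Or.inr (Or.inr ⟨hn, hk, h, d, rfl⟩)))))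
      -- A router of the last level has no child to send to. There `k` can only be the bus, whose
      -- departure would be due at time 7n + 1, after the end of route-in.
      · omega
    by_cases h : t + 1 < 3 * v.1.length + 2
    · rw [idealState_out_of_lt a b v d h, idealState_out_of_lt a b v d (by omega)]
    by_cases h' : t + 1 = 3 * v.1.length + 2
    · rw [idealState_out a b v d 0 (t := t + 1) (r := 0) (by omega) (by omega),
        idealState_out_of_lt a b v d (by omega), if_neg (by omega)]
    obtain ⟨k, r, hr, hk⟩ : ∃ k r, r < 4 ∧ t = 4 * k + 3 * v.1.length + 2 + r :=
      ⟨(t - (3 * v.1.length + 2)) / 4, (t - (3 * v.1.length + 2)) % 4, by omega, by omega⟩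
    rw [idealState_out a b v d k hk hr]
    have hrest : v.1.length < k ∧ k ≤ n → r ≠ d.toNat ∧ r ≠ 2 := fun ⟨h1, h2⟩ => by
      have h3 := route ⟨k, by omega⟩ h1
      have h4 := leave ⟨k, by omega⟩ h1
      simp only at h3 h4
      omega
    by_cases hr3 : r = 3
    · rw [idealState_out a b v d (k + 1) (t := t + 1) (r := 0) (by omega) (by omega),
        if_neg (by omega), if_neg (by omega)]
    rw [idealState_out a b v d k (t := t + 1) (r := r + 1) (by omega) (by omega)]
    by_cases hkn : k ≤ n
    · congr 1
      refine propext (and_congr_right fun _ => and_congr_right fun hlt => ?_)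
      have := hrest ⟨hlt, hkn⟩
      cases d <;> simp at this ⊢ <;> omega
    · rw [content_eq_none (by omega), ite_self, ite_self]

theorem runGates_layer (a : Fin n → Bool) (b : Bool) {t : ℕ} (ht : t ≤ 7 * n) :
    runGates (layer n t) (idealState a b t) = idealState a b (t + 1) :=
  runGates_eq (pairwise_layer n t) (fun _ hg => act_idealState a b hg)
    fun _ hq => idealState_of_untouched a b ht hq

theorem runGates_layer_reverse (a : Fin n → Bool) (b : Bool) {t : ℕ} (ht : t ≤ 7 * n) :
    runGates (layer n t) (idealState a b (t + 1)) = idealState a b t := by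
  rw [← runGates_layer a b ht, runGates_runGates (pairwise_layer n t)
    fun g hg => (isRouting_of_mem_layer hg).involutive]

/-! ### Loading the data and the complete ideal run -/

theorem content_congr {a : Fin n → Bool} (b b' : Bool) {k : ℕ} (hk : k ≠ n) :
    content a b k = content a b' k := by
  obtain h | h := Nat.lt_or_gt_of_ne hk
  · rw [content_of_lt h, content_of_lt h]
  · rw [content_eq_none h, content_eq_none h]

theorem idealState_zero (a : Fin n → Bool) (b : Bool) :
    idealState a b 0 = Sum.elim (extBasis a b) fun _ => none := by
  ext q : 1
  rcases q with k | _ | v | v | ⟨v, d⟩ <;> simp [idealState, content_fin]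

theorem eq_of_concat_prefix {a : Fin n → Bool} {v : Node n} {b : Bool} (hv : v.1.length + 1 = n)
    (h : v.1 ++ [b] <+: List.ofFn a) : (fun m : Fin n => (v.1 ++ [b]).getD m.val false) = a := by
  rw [h.eq_of_length (by simp [hv])]
  ext m
  simp [List.getD_eq_getElem?_getD]

theorem runGates_loadData (hn : 1 ≤ n) (x : (Fin n → Bool) → Bool) (a : Fin n → Bool) :
    runGates (loadData x) (idealState a false (7 * n + 1)) = idealState a (x a) (7 * n + 1) := by
  -- Since 7n + 1 = 4n + 3(n - 1) + 2 + 2, the bus is in phase 2 at the last router, in its output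
  -- register.
  have hout (v : Node n) (d b : Bool) (hv : v.1.length + 1 = n) :=
    idealState_out a b v d n (t := 7 * n + 1) (r := 2) (by omega) (by omega)
  refine runGates_eq (pairwise_loadData x) (fun g hg q hq => ?_) fun q hq => ?_
  · obtain ⟨v, hv, d, rfl⟩ := mem_loadData.1 hg
    obtain rfl : q = Reg.out v d := by simpa [Gate.support] using hq
    by_cases h : v.1 ++ [d] <+: List.ofFn a
    · rw [eq_of_concat_prefix hv h]
      cases hx : x a <;> simp [Gate.act, h, hout v d _ hv, v.2, content_self]
    -- Away from the selected cell the outputs are inactive, and the write gate fixes the inactive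
    -- state.
    · have h0 (b) : idealState a b (7 * n + 1) (Reg.out v d) = none := by
        rw [hout v d b hv, if_neg (by tauto)]
      simp only [Gate.act]
      split_ifs <;> simp [h0]
  · rcases q with k | _ | v | v | ⟨v, d⟩
    · have := k.2
      simp only [idealState]
      rw [if_neg (by omega), if_neg (by omega)]
    · simp only [idealState]
      rw [content_congr _ (x a) (by omega)]
    · simp only [idealState]
      rw [content_congr _ (x a) v.2.ne]
    · have := v.2
      simp only [idealState]
      split_ifs with h
      · rw [content_congr _ (x a) (by omega)]
      · rfl
    · have := v.2
      by_cases hv : v.1.length + 1 = n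
      · exact absurd (Finset.mem_singleton_self _)
          (hq _ (mem_loadData.2 ⟨v, hv, d, rfl⟩))
      · simp only [idealState]
        split_ifs with h
        · rw [content_congr _ (x a) (by omega)]
        · rfl

theorem route_forward (a : Fin n → Bool) (b : Bool) {s : Finset (Fin n → Bool)} (ha : a ∈ s) {m : ℕ}
    (hm : m ≤ 7 * n + 1) :
    runGates ((List.range m).map (layer n)).flatten (idealState a b 0) = idealState a b m ∧
      RespectAll (pathRegs s) ((List.range m).map (layer n)).flatten (idealState a b 0) := by
  induction m with
  | zero => exact ⟨rfl, trivial⟩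
  | succ m ih =>
    obtain ⟨h1, h2⟩ := ih (by omega)
    have h3 := runGates_layer a b (show m ≤ 7 * n by omega)
    simp only [List.range_succ, List.map_append, List.map_singleton, List.flatten_append,
      List.flatten_singleton]
    refine ⟨by rw [runGates_append, h1, h3], respectAll_append h2 ?_⟩
    rw [h1]
    exact respectAll_of_statusGood (pairwise_layer n m) (fun g => isRouting_of_mem_layer) ha
      (statusGood_idealState a b m) (h3 ▸ statusGood_idealState a b (m + 1))

theorem route_backward (a : Fin n → Bool) (b : Bool) {s : Finset (Fin n → Bool)} (ha : a ∈ s)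
    {m : ℕ} (hm : m ≤ 7 * n + 1) :
    runGates ((List.range m).map (layer n)).reverse.flatten (idealState a b m) =
        idealState a b 0 ∧
      RespectAll (pathRegs s) ((List.range m).map (layer n)).reverse.flatten
        (idealState a b m) := by
  induction m with
  | zero => exact ⟨rfl, trivial⟩
  | succ m ih =>
    obtain ⟨h1, h2⟩ := ih (by omega)
    have h3 := runGates_layer_reverse a b (show m ≤ 7 * n by omega)
    simp only [List.range_succ, List.map_append, List.map_singleton, List.reverse_append,
      List.reverse_singleton, List.singleton_append, List.flatten_cons]
    refine ⟨by rw [runGates_append, h3, h1], respectAll_append ?_ (h3 ▸ h2)⟩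
    exact respectAll_of_statusGood (pairwise_layer n m) (fun g => isRouting_of_mem_layer) ha
      (statusGood_idealState a b (m + 1)) (h3 ▸ statusGood_idealState a b m)

/-- The ideal query maps `|a⟩|0⟩` to `|a⟩|x a⟩` and respects the paths of all addresses in `s ∋ a`. -/
theorem run_circuit (hn : 1 ≤ n) (x : (Fin n → Bool) → Bool) (a : Fin n → Bool) {s : Finset (Fin n → Bool)}
    (ha : a ∈ s) :
    runGates (circuit x).flatten (Sum.elim (extBasis a false) fun _ => none) =
        Sum.elim (extBasis a (x a)) (fun _ => none) ∧
      RespectAll (pathRegs s) (circuit x).flatten (Sum.elim (extBasis a false) fun _ => none) := by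
  obtain ⟨h1, h2⟩ := route_forward a false ha le_rfl
  obtain ⟨h3, h4⟩ := route_backward a (x a) ha le_rfl
  have h5 := runGates_loadData hn x a
  simp only [← idealState_zero, circuit, routeIn, List.flatten_append, List.flatten_singleton]
  refine ⟨by rw [runGates_append, runGates_append, h1, h5, h3],
    respectAll_append (respectAll_append h2 ?_) ?_⟩
  · rw [h1]
    refine respectAll_of_statusGood (pairwise_loadData x) (fun g hg => ?_) ha
      (statusGood_idealState a _ _) (h5 ▸ statusGood_idealState a _ _)
    obtain ⟨v, -, b, rfl⟩ := mem_loadData.1 hg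
    exact .write v b _
  · rw [runGates_append, h1, h5]
    exact h4

/-! ### The infidelity as a linear functional -/

/-- The functional `ρ ↦ tr ρ - ⟨ψ| tr_inner ρ |ψ⟩`. -/
def defect (ψ : (Ext n → Level) → ℂ) : Op n →ₗ[ℂ] ℂ :=
  Matrix.traceLinearMap _ ℂ ℂ -
    { toFun ρ := star ψ ⬝ᵥ (traceInner ρ *ᵥ ψ)
      map_add' ρ σ := by
        have : traceInner (ρ + σ) = traceInner ρ + traceInner σ := by
          ext e e'
          simp [traceInner, Finset.sum_add_distrib]
        rw [this, Matrix.add_mulVec, dotProduct_add]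
      map_smul' z ρ := by
        have : traceInner (z • ρ) = z • traceInner ρ := by
          ext e e'
          simp [traceInner, Finset.mul_sum]
        rw [this, Matrix.smul_mulVec, dotProduct_smul]
        rfl }

theorem defect_apply (ψ : (Ext n → Level) → ℂ) (ρ : Op n) :
    defect ψ ρ = ρ.trace - star ψ ⬝ᵥ (traceInner ρ *ᵥ ψ) := rfl

theorem normSq_eq_sum (v : Config n → ℂ) :
    normSq v = ∑ f : Inner n → Level, ∑ e : Ext n → Level, ‖v (Sum.elim e f)‖ ^ 2 := by
  rw [normSq, ← (Equiv.sumArrowEquivProdArrow (Ext n) (Inner n) Level).symm.sum_comp,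
    Fintype.sum_prod_type_right]
  rfl

theorem dotProduct_traceInner_dyad (ψ : (Ext n → Level) → ℂ) (v : Config n → ℂ) :
    star ψ ⬝ᵥ (traceInner (dyad v) *ᵥ ψ) =
      ((∑ f : Inner n → Level, ‖∑ e, star (ψ e) * v (Sum.elim e f)‖ ^ 2 : ℝ) : ℂ) := by
  push_cast
  simp only [← Complex.mul_conj', map_sum, map_mul, Finset.sum_mul_sum]
  simp only [dotProduct, Matrix.mulVec, traceInner, dyad, Matrix.of_apply,
    Matrix.vecMulVec_apply, Finset.mul_sum, Finset.sum_mul, Pi.star_apply]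
  symm
  rw [Finset.sum_comm]
  refine Finset.sum_congr rfl fun e _ => ?_
  rw [Finset.sum_comm]
  refine Finset.sum_congr rfl fun e' _ => Finset.sum_congr rfl fun f _ => ?_
  simp only [Complex.star_def, Complex.conj_conj]
  ring

theorem re_defect_dyad (ψ : (Ext n → Level) → ℂ) (v : Config n → ℂ) :
    (defect ψ (dyad v)).re = ∑ f : Inner n → Level,
      (∑ e, ‖v (Sum.elim e f)‖ ^ 2 - ‖∑ e, star (ψ e) * v (Sum.elim e f)‖ ^ 2) := by
  rw [defect_apply, trace_dyad, dotProduct_traceInner_dyad, ← Complex.ofReal_sub,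
    Complex.ofReal_re, normSq_eq_sum, Finset.sum_sub_distrib]

theorem re_defect_dyad_le (ψ : (Ext n → Level) → ℂ) (v : Config n → ℂ) :
    (defect ψ (dyad v)).re ≤ normSq v := by
  rw [re_defect_dyad, normSq_eq_sum]
  exact Finset.sum_le_sum fun f _ => sub_le_self _ (sq_nonneg _)

/-- Cauchy–Schwarz against the unit vector `ψ`, separately for each basis state of the internal
registers. -/
theorem re_defect_dyad_nonneg {ψ : (Ext n → Level) → ℂ} (hψ : ∑ e, ‖ψ e‖ ^ 2 = 1)
    (v : Config n → ℂ) : 0 ≤ (defect ψ (dyad v)).re := by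
  rw [re_defect_dyad]
  refine Finset.sum_nonneg fun f _ => sub_nonneg.2 ?_
  calc ‖∑ e, star (ψ e) * v (Sum.elim e f)‖ ^ 2
      ≤ (∑ e, ‖ψ e‖ * ‖v (Sum.elim e f)‖) ^ 2 := by
        refine pow_le_pow_left₀ (norm_nonneg _) ((norm_sum_le _ _).trans_eq ?_) 2
        simp
    _ ≤ (∑ e, ‖ψ e‖ ^ 2) * ∑ e, ‖v (Sum.elim e f)‖ ^ 2 :=
        Finset.sum_mul_sq_le_sq_mul_sq _ _ _
    _ = _ := by rw [hψ, one_mul]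

theorem sum_norm_sq_of_injective {ι X : Type*} [Fintype X] [DecidableEq X] {E : ι → X}
    (hE : Function.Injective E) (s : Finset ι) (β : ι → ℂ) :
    ∑ y, ‖∑ i ∈ s, if y = E i then β i else 0‖ ^ 2 = ∑ i ∈ s, ‖β i‖ ^ 2 := by
  classical
  have h (y : X) : ‖∑ i ∈ s, if y = E i then β i else 0‖ ^ 2 =
      ∑ i ∈ s, if y = E i then ‖β i‖ ^ 2 else 0 := by
    by_cases hy : ∃ i ∈ s, y = E i
    · obtain ⟨i, hi, rfl⟩ := hy
      simp [hE.eq_iff, hi]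
    · push Not at hy
      rw [Finset.sum_eq_zero fun i hi => if_neg (hy i hi),
        Finset.sum_eq_zero fun i hi => if_neg (hy i hi)]
      simp
  simp only [h]
  rw [Finset.sum_comm]
  simp

theorem extBasis_injective (y : (Fin n → Bool) → Bool) :
    Function.Injective fun a => extBasis a (y a) := by
  intro a a' h
  ext k
  have h1 := content_of_lt (a := a) (b := y a) k.2
  have h2 := content_of_lt (a := a') (b := y a') k.2
  have h' : extBasis a (y a) = extBasis a' (y a') := h
  rw [content, h'] at h1
  rw [content, h1] at h2
  simpa using h2

theorem idealOutput_extBasis (x : (Fin n → Bool) → Bool) (α : (Fin n → Bool) → ℂ)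
    (a : Fin n → Bool) : idealOutput x α (extBasis a (x a)) = α a := by
  have h (a' : Fin n → Bool) : extBasis a (x a) = extBasis a' (x a') ↔ a = a' :=
    (extBasis_injective x).eq_iff
  simp [idealOutput, h]

/-- Once the internal registers of `K` are inactive, nothing internal records the address. The
internal factor on the right is the same for all branches, so tracing it out causes no decoherence
between them. -/
theorem branch_output {K : Finset (Reg n)} (hK : ∀ k : Ext n, Reg.ext k ∈ K)
    {φ : Config n → ℂ} (hφ : IgnoresOn K φ) (e₀ e : Ext n → Level) (f : Inner n → Level) :
    branch K (Sum.elim e₀ fun _ => none) φ (Sum.elim e f) =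
      if e = e₀ then branch K (fun _ => none) φ (Sum.elim (fun _ => none) f) else 0 := by
  have hf : φ (Sum.elim e f) = φ (Sum.elim (fun _ => none) f) := by
    refine hφ _ _ fun q hq => ?_
    rcases q with k | q
    · exact absurd (hK k) hq
    · rfl
  by_cases he : e = e₀
  · subst he
    simp only [branch, hf, if_true]
    congr 1
    refine propext (forall₂_congr fun q _ => ?_)
    rcases q with k | q <;> simp
  · rw [if_neg he, branch, if_neg]
    intro h
    exact he (funext fun k => h _ (hK k))

/-- With w the weight of `s` and `η` the common internal vector, the squared norm is w‖η‖² and the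
squared overlap with the ideal output is w²‖η‖²; the difference is (1 - w) times the former. -/
theorem defect_branches_le (x : (Fin n → Bool) → Bool) {α : (Fin n → Bool) → ℂ}
    (hα : ∑ a, ‖α a‖ ^ 2 = 1) (s : Finset (Fin n → Bool)) {K : Finset (Reg n)}
    (hK : ∀ a ∈ s, ∀ k : Ext n, Reg.ext k ∈ K) {φ : Config n → ℂ} (hφ : IgnoresOn K φ) :
    (defect (idealOutput x α) (dyad (∑ a ∈ s,
      α a • branch K (Sum.elim (extBasis a (x a)) fun _ => none) φ))).re ≤
    (∑ a ∈ sᶜ, ‖α a‖ ^ 2) * ∑ a ∈ s, ‖α a‖ ^ 2 *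
      normSq (branch K (Sum.elim (extBasis a (x a)) fun _ => none) φ) := by
  set η : (Inner n → Level) → ℂ := fun f =>
    branch K (fun _ => none) φ (Sum.elim (fun _ => none) f) with hη
  have hb : ∀ a ∈ s, ∀ e f, branch K (Sum.elim (extBasis a (x a)) fun _ => none) φ (Sum.elim e f) =
      if e = extBasis a (x a) then η f else 0 := fun a ha e f => branch_output (hK a ha) hφ _ _ _
  have hn : ∀ a ∈ s, normSq (branch K (Sum.elim (extBasis a (x a)) fun _ => none) φ) =
      ∑ f, ‖η f‖ ^ 2 := by
    intro a ha
    rw [normSq_eq_sum]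
    simp only [hb a ha, apply_ite norm, norm_zero, ite_pow]
    simp
  have hv (e f) : (∑ a ∈ s, α a • branch K (Sum.elim (extBasis a (x a)) fun _ => none) φ)
      (Sum.elim e f) = ∑ a ∈ s, if e = extBasis a (x a) then α a * η f else 0 := by
    rw [Finset.sum_apply]
    exact Finset.sum_congr rfl fun a ha => by simp [hb a ha]
  have hs : ∑ a ∈ sᶜ, ‖α a‖ ^ 2 = 1 - ∑ a ∈ s, ‖α a‖ ^ 2 := by
    rw [← hα, ← Finset.sum_add_sum_compl s]
    ring
  have hsum : ∑ a ∈ s, ‖α a‖ ^ 2 *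
      normSq (branch K (Sum.elim (extBasis a (x a)) fun _ => none) φ) =
      ∑ a ∈ s, ‖α a‖ ^ 2 * ∑ f, ‖η f‖ ^ 2 := Finset.sum_congr rfl fun a ha => by rw [hn a ha]
  rw [hsum, ← Finset.sum_mul, re_defect_dyad, hs, ← mul_assoc, Finset.mul_sum]
  refine Finset.sum_le_sum fun f _ => le_of_eq ?_
  have h1 : ∑ e, ‖(∑ a ∈ s, α a • branch K (Sum.elim (extBasis a (x a)) fun _ => none) φ)
      (Sum.elim e f)‖ ^ 2 = (∑ a ∈ s, ‖α a‖ ^ 2) * ‖η f‖ ^ 2 := by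
    simp only [hv]
    rw [sum_norm_sq_of_injective (extBasis_injective x), Finset.sum_mul]
    simp [mul_pow]
  have h2 : ∑ e, star (idealOutput x α e) *
      (∑ a ∈ s, α a • branch K (Sum.elim (extBasis a (x a)) fun _ => none) φ)
      (Sum.elim e f) = ((∑ a ∈ s, ‖α a‖ ^ 2 : ℝ) : ℂ) * η f := by
    simp only [hv, Finset.mul_sum]
    rw [Finset.sum_comm]
    push_cast
    rw [Finset.sum_mul]
    refine Finset.sum_congr rfl fun a _ => ?_
    simp only [mul_ite, mul_zero, Finset.sum_ite_eq', Finset.mem_univ, if_true,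
      idealOutput_extBasis, ← mul_assoc]
    rw [← Complex.conj_mul']
    rfl
  rw [h1, h2, norm_mul, Complex.norm_real, mul_pow, Real.norm_eq_abs, sq_abs]
  ring

/-! ### Bound for a fixed set of faults -/

open scoped Classical in
/-- Whether a step is a fault that touches the path of `a`. -/
def hits (a : Fin n → Bool) : Event n → ℝ
  | .gate _ => 0
  | .fault S _ => if Disjoint S (pathRegs {a}) then 0 else 1

theorem hits_nonneg (a : Fin n → Bool) (e : Event n) : 0 ≤ hits a e := by
  cases e with
  | gate g => exact le_rfl
  | fault S f =>
    simp only [hits]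
    split_ifs <;> norm_num

theorem disjoint_pathRegs {S : Finset (Reg n)} {s : Finset (Fin n → Bool)}
    (h : ∀ a ∈ s, Disjoint S (pathRegs {a})) : Disjoint S (pathRegs s) := by
  refine Finset.disjoint_left.2 fun q hq hq' => ?_
  obtain ⟨a, ha, hqa⟩ := mem_pathRegs.1 hq'
  exact Finset.disjoint_left.1 (h a ha) hq (mem_pathRegs.2 ⟨a, by simp, hqa⟩)

theorem one_le_sum_hits {a : Fin n → Bool} {l : List (Event n)} {S : Finset (Reg n)} {f : Fault S}
    (h : .fault S f ∈ l) (hS : ¬ Disjoint S (pathRegs {a})) : 1 ≤ (l.map (hits a)).sum := by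
  refine le_trans ?_ (List.single_le_sum ?_ _ (List.mem_map_of_mem h))
  · simp [hits, hS]
  · simp only [List.mem_map]
    rintro _ ⟨e, -, rfl⟩
    exact hits_nonneg a e

/-- The superposition of the inputs `|a⟩|0⟩` for the addresses `a` in `s`. -/
def inputPart (s : Finset (Fin n → Bool)) (α : (Fin n → Bool) → ℂ) : Config n → ℂ :=
  fun c => ∑ a ∈ s, if c = Sum.elim (extBasis a false) (fun _ => none) then α a else 0

theorem input_injective : Function.Injective fun a : Fin n → Bool =>
    (Sum.elim (extBasis a false) (fun _ => none) : Config n) := by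
  intro a a' h
  refine extBasis_injective (fun _ => false) (funext fun k => ?_)
  exact congrFun h (Sum.inl k)

theorem normSq_inputPart (s : Finset (Fin n → Bool)) (α : (Fin n → Bool) → ℂ) :
    normSq (inputPart s α) = ∑ a ∈ s, ‖α a‖ ^ 2 :=
  sum_norm_sq_of_injective input_injective s α

theorem inputPart_add_compl (s : Finset (Fin n → Bool)) (α : (Fin n → Bool) → ℂ) :
    inputPart s α + inputPart sᶜ α = inputState α :=
  funext fun _ => Finset.sum_add_sum_compl s _

/-- The state `|w⟩` of the registers off `K`. -/
def inactiveOff (K : Finset (Reg n)) : Config n → ℂ :=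
  open scoped Classical in fun c => if ∀ q, q ∉ K → c q = none then 1 else 0

theorem inactiveOff_ignoresOn (K : Finset (Reg n)) : IgnoresOn K (inactiveOff K) := by
  intro c c' h
  simp only [inactiveOff]
  congr 1
  exact propext (forall₂_congr fun q hq => by rw [h q hq])

theorem ext_mem_pathRegs {s : Finset (Fin n → Bool)} {a : Fin n → Bool} (ha : a ∈ s) (k : Ext n) :
    Reg.ext k ∈ pathRegs s := mem_pathRegs.2 ⟨a, ha, trivial⟩

theorem branch_input {s : Finset (Fin n → Bool)} {a : Fin n → Bool} (ha : a ∈ s) (c : Config n) :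
    branch (pathRegs s) (Sum.elim (extBasis a false) fun _ => none) (inactiveOff (pathRegs s)) c =
      if c = Sum.elim (extBasis a false) (fun _ => none) then 1 else 0 := by
  have h : c = Sum.elim (extBasis a false) (fun _ => none) ↔
      (∀ q ∈ pathRegs s, c q = Sum.elim (extBasis a false) (fun _ => none) q) ∧
        ∀ q, q ∉ pathRegs s → c q = none := by
    constructor
    · rintro rfl
      refine ⟨fun _ _ => rfl, fun q hq => ?_⟩
      rcases q with k | q
      · exact absurd (ext_mem_pathRegs ha k) hq
      · rfl
    · rintro ⟨h1, h2⟩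
      ext q : 1
      by_cases hq : q ∈ pathRegs s
      · exact h1 q hq
      · rw [h2 q hq]
        rcases q with k | q
        · exact absurd (ext_mem_pathRegs ha k) hq
        · rfl
  simp only [branch, inactiveOff, h, ← ite_and]

theorem inputPart_eq (s : Finset (Fin n → Bool)) (α : (Fin n → Bool) → ℂ) :
    inputPart s α = ∑ a ∈ s, α a • branch (pathRegs s) (Sum.elim (extBasis a false) fun _ => none)
      (inactiveOff (pathRegs s)) := by
  ext c
  rw [Finset.sum_apply]
  refine Finset.sum_congr rfl fun a ha => ?_
  rw [Pi.smul_apply, branch_input ha]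
  simp

theorem normSq_branch_input {s : Finset (Fin n → Bool)} {a : Fin n → Bool} (ha : a ∈ s) :
    normSq (branch (pathRegs s) (Sum.elim (extBasis a false) fun _ => none)
      (inactiveOff (pathRegs s))) = 1 := by
  simp only [normSq, branch_input ha, apply_ite norm, norm_one, norm_zero, ite_pow]
  simp

theorem sum_norm_idealOutput (x : (Fin n → Bool) → Bool) {α : (Fin n → Bool) → ℂ}
    (hα : ∑ a, ‖α a‖ ^ 2 = 1) : ∑ e, ‖idealOutput x α e‖ ^ 2 = 1 := by
  rw [← hα]
  exact sum_norm_sq_of_injective (extBasis_injective x) Finset.univ α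

theorem involutive_of_mem_circuit {x : (Fin n → Bool) → Bool} {g : Gate n}
    (hg : g ∈ (circuit x).flatten) : Function.Involutive g.act := by
  obtain ⟨L, hL, hg⟩ := List.mem_flatten.1 hg
  exact (isRouting_of_mem_circuit hL hg).involutive

/-- If certain faults happen for sure, the defect is governed by the weight of the addresses whose
path they touch. -/
theorem defect_evolve_le (hn : 1 ≤ n) (x : (Fin n → Bool) → Bool) {α : (Fin n → Bool) → ℂ}
    (hα : ∑ a, ‖α a‖ ^ 2 = 1) {l : List (Event n)} (hl : gatesOf l = (circuit x).flatten) :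
    (defect (idealOutput x α) (evolve l (dyad (inputState α)))).re ≤
      (l.map fun e => ∑ a, 4 * ‖α a‖ ^ 2 * hits a e).sum := by
  classical
  set Λ := defect (idealOutput x α) with hΛ
  set s : Finset (Fin n → Bool) := Finset.univ.filter fun a =>
    ∀ S f, Event.fault S f ∈ l → Disjoint S (pathRegs {a}) with hs
  have hinv : ∀ g ∈ gatesOf l, Function.Involutive g.act := fun g hg =>
    involutive_of_mem_circuit (hl ▸ hg)
  -- Addresses in `s` meet no fault, so their branches follow the ideal run on `pathRegs s`.
  have good : (Λ (evolve l (dyad (inputPart s α)))).re ≤ ∑ a ∈ sᶜ, ‖α a‖ ^ 2 := by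
    rw [inputPart_eq]
    refine (evolve_branches_le Λ s α (∑ a ∈ sᶜ, ‖α a‖ ^ 2)
      (fun a => Sum.elim (extBasis a (x a)) fun _ => none)
      (fun φ hφ => defect_branches_le x hα s (fun a ha => ext_mem_pathRegs ha) hφ) l hinv
      (fun S f hf => disjoint_pathRegs fun a ha => (Finset.mem_filter.1 ha).2 S f hf)
      (fun a => Sum.elim (extBasis a false) fun _ => none)
      (fun a ha => hl ▸ (run_circuit hn x a ha).2) (fun a ha => hl ▸ (run_circuit hn x a ha).1)
      _ (inactiveOff_ignoresOn _)).trans ?_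
    have hsum : ∑ a ∈ s, ‖α a‖ ^ 2 * normSq (branch (pathRegs s)
        (Sum.elim (extBasis a false) fun _ => none) (inactiveOff (pathRegs s))) ≤ 1 := by
      rw [← hα]
      refine (Finset.sum_le_sum fun a ha => ?_).trans (Finset.sum_le_sum_of_subset_of_nonneg
        (Finset.subset_univ s) fun a _ _ => sq_nonneg ‖α a‖)
      rw [normSq_branch_input ha, mul_one]
    exact mul_le_of_le_one_right (Finset.sum_nonneg fun a _ => sq_nonneg _) hsum
  have bad : (Λ (evolve l (dyad (inputPart sᶜ α)))).re ≤ ∑ a ∈ sᶜ, ‖α a‖ ^ 2 := by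
    rw [← normSq_inputPart]
    exact evolve_dyad_le Λ (re_defect_dyad_le _) l hinv _
  -- The parallelogram identity: twice the good bound plus twice the bad one, the difference term
  -- being nonnegative.
  have total : (Λ (evolve l (dyad (inputState α)))).re ≤ 4 * ∑ a ∈ sᶜ, ‖α a‖ ^ 2 := by
    have h := congrArg (fun ρ => (Λ (evolve l ρ)).re)
      (dyad_add_dyad_sub (inputPart s α) (inputPart sᶜ α))
    simp only [evolve_add, evolve_smul, map_add, map_smul, Complex.add_re, inputPart_add_compl,
      smul_eq_mul, Complex.mul_re, Complex.re_ofNat, Complex.im_ofNat, zero_mul, sub_zero] at h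
    have := evolve_dyad_nonneg Λ (re_defect_dyad_nonneg (sum_norm_idealOutput x hα)) l
      (inputPart s α - inputPart sᶜ α)
    linarith
  have swap : (l.map fun e => ∑ a, 4 * ‖α a‖ ^ 2 * hits a e).sum =
      ∑ a, 4 * ‖α a‖ ^ 2 * (l.map (hits a)).sum := by
    clear * -
    induction l with
    | nil => simp
    | cons e l ih => simp [ih, mul_add, Finset.sum_add_distrib]
  have hits_sum (a) : 0 ≤ (l.map (hits a)).sum := List.sum_nonneg (by
    simp only [List.mem_map]
    rintro _ ⟨e, -, rfl⟩
    exact hits_nonneg a e)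
  rw [swap]
  refine total.trans ?_
  rw [Finset.mul_sum]
  refine (Finset.sum_le_sum fun a ha => ?_).trans (Finset.sum_le_sum_of_subset_of_nonneg
    (Finset.subset_univ sᶜ) fun a _ _ => by have := hits_sum a; positivity)
  have ha : ∃ S f, Event.fault S f ∈ l ∧ ¬ Disjoint S (pathRegs {a}) := by
    simpa [hs] using ha
  obtain ⟨S, f, hf, hS⟩ := ha
  exact le_mul_of_one_le_right (by positivity) (one_le_sum_hits hf hS)

/-! ### The noisy query as a list of steps -/

def layerEvents (dur : ℕ → ℕ) (𝒩 : Noise n) (s : ℕ) (L : List (Gate n)) : List (Event n) :=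
  (L.flatMap fun g => [.gate g, .fault _ (𝒩.gate s g)]) ++
    (List.range (layerTime dur L)).flatMap fun r =>
      (Finset.univ : Finset (Reg n)).toList.map fun q => .fault _ (𝒩.idle s r q)

def runEvents (dur : ℕ → ℕ) (𝒩 : Noise n) : ℕ → List (List (Gate n)) → List (Event n)
  | _, [] => []
  | s, L :: Ls => layerEvents dur 𝒩 s L ++ runEvents dur 𝒩 (s + 1) Ls

theorem noisyMap_gate (g : Gate n) (ρ : Op n) :
    (Event.gate g).noisyMap ρ = g.op * ρ * g.opᴴ := rfl

theorem noisyMap_fault {S : Finset (Reg n)} (f : Fault S) (ρ : Op n) :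
    (Event.fault S f).noisyMap ρ = f.apply ρ := by
  simp [Event.noisyMap, Event.map, Fault.apply]

theorem noisyEvolve_append (l l' : List (Event n)) (ρ : Op n) :
    noisyEvolve (l ++ l') ρ = noisyEvolve l' (noisyEvolve l ρ) := List.foldl_append

theorem noisyEvolve_layerEvents (dur : ℕ → ℕ) (𝒩 : Noise n) (s : ℕ) (L : List (Gate n)) (ρ : Op n) :
    noisyEvolve (layerEvents dur 𝒩 s L) ρ = noisyLayer dur 𝒩 s L ρ := by
  rw [layerEvents, noisyEvolve_append, noisyLayer]
  simp only [noisyEvolve, List.foldl_flatMap, List.foldl_map, List.foldl_cons, List.foldl_nil,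
    noisyMap_gate, noisyMap_fault]

theorem noisyEvolve_runEvents (dur : ℕ → ℕ) (𝒩 : Noise n) (s : ℕ) (Ls : List (List (Gate n)))
    (ρ : Op n) : noisyEvolve (runEvents dur 𝒩 s Ls) ρ = noisyRun dur 𝒩 s Ls ρ := by
  induction Ls generalizing s ρ with
  | nil => rfl
  | cons L Ls ih => rw [runEvents, noisyEvolve_append, noisyEvolve_layerEvents, ih, noisyRun]

theorem gatesOf_runEvents (dur : ℕ → ℕ) (𝒩 : Noise n) (s : ℕ) (Ls : List (List (Gate n))) :
    gatesOf (runEvents dur 𝒩 s Ls) = Ls.flatten := by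
  induction Ls generalizing s with
  | nil => rfl
  | cons L Ls ih =>
    have h : gatesOf (layerEvents dur 𝒩 s L) = L := by
      simp [gatesOf, layerEvents, List.flatMap_assoc, List.flatMap_map]
    rw [runEvents, gatesOf, List.flatMap_append, ← gatesOf, ← gatesOf, ih, h, List.flatten_cons]

open scoped Classical in
/-- The probability of a step if it is a fault that touches the path of `a`. -/
def risk (a : Fin n → Bool) : Event n → ℝ
  | .gate _ => 0
  | .fault S f => if Disjoint S (pathRegs {a}) then 0 else f.prob

/-- The infidelity is at most four times the expected number of faults that touch a path. -/
theorem infidelity_le_of_risk (hn : 1 ≤ n) (dur : ℕ → ℕ) (𝒩 : Noise n)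
    (x : (Fin n → Bool) → Bool) {α : (Fin n → Bool) → ℂ} (hα : ∑ a, ‖α a‖ ^ 2 = 1) {B : ℝ}
    (hB : ∀ a, ((runEvents dur 𝒩 0 (circuit x)).map (risk a)).sum ≤ B) :
    infidelity dur 𝒩 x α ≤ 4 * B := by
  set l := runEvents dur 𝒩 0 (circuit x) with hl
  have hgates : gatesOf l = (circuit x).flatten := gatesOf_runEvents _ _ _ _
  -- Trace preservation replaces the constant 1 in the infidelity by the trace, which makes the
  -- expression linear in the state.
  have htr : (noisyEvolve l (dyad (inputState α))).trace = 1 := by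
    rw [trace_noisyEvolve (fun g hg => involutive_of_mem_circuit (hgates ▸ hg)), trace_dyad]
    have := normSq_inputPart Finset.univ α
    rw [hα] at this
    exact_mod_cast this
  have h1 : infidelity dur 𝒩 x α =
      (defect (idealOutput x α) (noisyEvolve l (dyad (inputState α)))).re := by
    rw [defect_apply, htr, hl, noisyEvolve_runEvents, Complex.sub_re, Complex.one_re]
    rfl
  rw [h1, re_noisyEvolve]
  refine (mean_mono (Ψ := fun r => 0 + (r.map fun e => ∑ a, 4 * ‖α a‖ ^ 2 * hits a e).sum)
    fun r hr => ?_).trans ?_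
  · rw [zero_add]
    exact defect_evolve_le hn x hα (hr.trans hgates)
  rw [mean_sum _ (fun g => by simp [hits]), zero_add]
  have swap : (l.map (Event.meanWeight fun e => ∑ a, 4 * ‖α a‖ ^ 2 * hits a e)).sum =
      ∑ a, 4 * ‖α a‖ ^ 2 * (l.map (risk a)).sum := by
    clear * -
    induction l with
    | nil => simp
    | cons e l ih =>
      cases e with
      | gate g => simpa [risk, Event.meanWeight] using ih
      | fault S f =>
        simp only [List.map_cons, List.sum_cons, ih, mul_add, Finset.sum_add_distrib]
        congr 1
        rw [Event.meanWeight, Finset.mul_sum]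
        refine Finset.sum_congr rfl fun a _ => ?_
        simp only [hits, risk]
        split_ifs <;> ring
  rw [swap]
  calc ∑ a, 4 * ‖α a‖ ^ 2 * (l.map (risk a)).sum
      ≤ ∑ a, 4 * ‖α a‖ ^ 2 * B :=
        Finset.sum_le_sum fun a _ => mul_le_mul_of_nonneg_left (hB a) (by positivity)
    _ = 4 * B := by rw [← Finset.sum_mul, ← Finset.mul_sum, hα, mul_one]

/-! ### Counting the operations on a path -/

/-- The total weight of a list. -/
def totalOf {ι : Type*} (f : ι → ℝ) (L : List ι) : ℝ := (L.map f).sum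

theorem totalOf_append {ι : Type*} (f : ι → ℝ) (L L' : List ι) :
    totalOf f (L ++ L') = totalOf f L + totalOf f L' := by simp [totalOf]

theorem totalOf_flatMap {ι κ : Type*} (f : ι → ℝ) (g : κ → List ι) (L : List κ) :
    totalOf f (L.flatMap g) = totalOf (fun k => totalOf f (g k)) L := by
  induction L with
  | nil => rfl
  | cons k L ih => simpa [totalOf] using ih

theorem totalOf_mono {ι : Type*} {f g : ι → ℝ} {L : List ι} (h : ∀ i ∈ L, f i ≤ g i) :
    totalOf f L ≤ totalOf g L := List.sum_le_sum h

theorem totalOf_eq_zero {ι : Type*} {f : ι → ℝ} {L : List ι} (h : ∀ i ∈ L, f i = 0) :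
    totalOf f L = 0 := by
  rw [totalOf, List.map_congr_left h]
  simp

theorem totalOf_toList {ι : Type*} (f : ι → ℝ) (s : Finset ι) :
    totalOf f s.toList = ∑ i ∈ s, f i := Finset.sum_map_toList s f

theorem totalOf_finRange (f : Fin n → ℝ) : totalOf f (List.finRange n) = ∑ i, f i :=
  (Fin.sum_univ_def f).symm

theorem totalOf_range (f : ℕ → ℝ) (m : ℕ) : totalOf f (List.range m) = ∑ i ∈ Finset.range m, f i :=
  rfl

open scoped Classical in
/-- The error rate of a gate, if it touches the path of `a`. -/
def gateRisk (ε : Rates) (a : Fin n → Bool) (g : Gate n) : ℝ :=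
  if Disjoint g.support (pathRegs {a}) then 0 else ε.gate g

theorem Rates.longRange_nonneg (ε : Rates) (m : ℕ) : 0 ≤ ε.longRange m :=
  le_min (mul_nonneg (Nat.cast_nonneg _) ε.qubit_nonneg) ε.bell_nonneg

theorem Rates.gate_nonneg (ε : Rates) (g : Gate n) : 0 ≤ ε.gate g := by
  cases g with
  | swap => exact ε.swap_nonneg
  | cswap => exact ε.cswap_nonneg
  | longSwap a b => exact mul_nonneg (by norm_num) (ε.longRange_nonneg _)
  | write => exact ε.idle_nonneg

theorem gateRisk_le (ε : Rates) (a : Fin n → Bool) (g : Gate n) : gateRisk ε a g ≤ ε.gate g := by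
  rw [gateRisk]
  split_ifs
  · exact ε.gate_nonneg g
  · exact le_rfl

theorem gateRisk_of_disjoint (ε : Rates) {a : Fin n → Bool} {g : Gate n}
    (h : ∀ q ∈ g.support, ¬ OnPath a q) : gateRisk ε a g = 0 :=
  if_pos (Finset.disjoint_left.2 fun q hq hq' => h q hq (by simpa [mem_pathRegs] using hq'))

/-- There are n + 1 external registers, the entry, and three registers per depth: status, incident
register, and the one output on the path. -/
theorem card_pathRegs_le (a : Fin n → Bool) : (pathRegs {a}).card ≤ 4 * n + 2 := by
  let f : Reg n → Ext n ⊕ (Unit ⊕ (Fin n × Fin 3))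
    | Sum.inl k => .inl k
    | Sum.inr .entry => .inr (.inl ())
    | Sum.inr (.status v) => .inr (.inr (⟨v.1.length, v.2⟩, 0))
    | Sum.inr (.inp v) => .inr (.inr (⟨v.1.length, v.2⟩, 1))
    | Sum.inr (.out v _) => .inr (.inr (⟨v.1.length, v.2⟩, 2))
  have hp {v w : Node n} (hv : v.1 <+: List.ofFn a) (hw : w.1 <+: List.ofFn a)
      (h : v.1.length = w.1.length) : v = w := Subtype.ext <| by
    rw [List.prefix_iff_eq_take.1 hv, List.prefix_iff_eq_take.1 hw, h]
  have hcard := Finset.card_le_card_of_injOn (s := pathRegs {a}) (t := Finset.univ) f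
    (fun _ _ => Finset.mem_univ _) (by
      intro q hq q' hq' h
      have hq : OnPath a q := by simpa [mem_pathRegs] using hq
      have hq' : OnPath a q' := by simpa [mem_pathRegs] using hq'
      rcases q with k | _ | v | v | ⟨v, b⟩ <;> rcases q' with k' | _ | v' | v' | ⟨v', b'⟩ <;>
        simp [f] at h
      · rw [h]
      · rfl
      · rw [hp hq hq' h]
      · rw [hp hq hq' h]
      · obtain rfl := hp (prefix_of_concat_prefix hq) (prefix_of_concat_prefix hq') h
        rw [← (concat_prefix_iff.1 hq).2, ← (concat_prefix_iff.1 hq').2])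
  refine hcard.trans_eq ?_
  simp
  omega

/-- A prefix of a given word is determined by its length, so the exponential sum over routers
collapses to one term per depth. -/
theorem sum_ite_prefix_le (a : Fin n → Bool) {h : ℕ → ℝ} (hh : ∀ l, 0 ≤ h l) :
    (open scoped Classical in
      ∑ v : Node n, if v.1 <+: List.ofFn a then h v.1.length else 0) ≤
      ∑ l ∈ Finset.range n, h l := by
  classical
  rw [← Finset.sum_filter]
  have hinj : Set.InjOn (fun v : Node n => v.1.length)
      (Finset.univ.filter fun v : Node n => v.1 <+: List.ofFn a : Finset (Node n)) := by
    intro v hv w hw hvw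
    simp only [Finset.coe_filter, Finset.mem_univ, true_and, Set.mem_ofPred_eq] at hv hw hvw
    exact Subtype.ext (by
      rw [List.prefix_iff_eq_take.1 hv, List.prefix_iff_eq_take.1 hw, hvw])
  rw [← Finset.sum_image (f := h) hinj]
  refine Finset.sum_le_sum_of_subset_of_nonneg (fun l hl => ?_) fun l _ _ => hh l
  obtain ⟨v, -, rfl⟩ := Finset.mem_image.1 hl
  exact Finset.mem_range.2 v.2

theorem prefix_of_mem_routerGates {a : Fin n → Bool} {t : ℕ} {v : Node n} {k : Ext n} {g : Gate n}
    (hg : g ∈ routerGates t v k) {q : Reg n} (hq : q ∈ g.support) (ha : OnPath a q) :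
    v.1 <+: List.ofFn a := by
  have h := touches_of_mem hg hq
  rcases q with _ | _ | w | w | ⟨w, b⟩
  · exact h.elim
  · rw [List.length_eq_zero_iff.1 h.1]
    exact List.nil_prefix
  · exact h ▸ ha
  · obtain ⟨rfl, -⟩ | ⟨b, hb, -⟩ := h
    · exact ha
    · exact prefix_of_concat_prefix (hb ▸ ha : v.1 ++ [b] <+: _)
  · obtain rfl : w = v := h
    exact prefix_of_concat_prefix ha

theorem sum_range_ite_le {m t₀ : ℕ} {y : ℝ} (hy : 0 ≤ y) :
    (∑ t ∈ Finset.range m, if t = t₀ then y else 0) ≤ y := by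
  rw [Finset.sum_ite_eq']
  split_ifs
  · exact le_rfl
  · exact hy

/-- Each kind of gate gets an indicator of its time, so that the later sum over `t` counts it once.
The term 6 εL comes from the two outgoing long-range SWAPs, three CNOTs each. -/
theorem totalOf_routerGates_le {ε : Rates} {εL : ℝ} (hε : ∀ t < 7 * n + 1, ∀ p q : Reg n,
    Gate.longSwap p q ∈ layer n t → ε.longRange (gridDist p q) ≤ εL) (hL : 0 ≤ εL) (a : Fin n → Bool) {t : ℕ} (ht : t < 7 * n + 1) (v : Node n)
    (k : Ext n) : totalOf (gateRisk ε a) (routerGates t v k) ≤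
      open scoped Classical in if v.1 <+: List.ofFn a then
        (if t = 4 * k.val + 1 then if v.1.length = 0 then ε.swap else 0 else 0) +
        (if t = 4 * k.val + 3 * v.1.length + 2 then
          if v.1.length = k.val then ε.swap else 0 else 0) +
        (if t = 4 * k.val + 3 * v.1.length + 2 then ε.cswap else 0) +
        (if t = 4 * k.val + 3 * v.1.length + 3 then ε.cswap else 0) +
        (if t = 4 * k.val + 3 * v.1.length + 4 then 6 * εL else 0) else 0 := by
  have h1 := ε.swap_nonneg
  have h2 := ε.cswap_nonneg
  by_cases hv : v.1 <+: List.ofFn a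
  swap
  · rw [if_neg hv]
    refine (totalOf_eq_zero fun g hg => gateRisk_of_disjoint ε fun q hq ha => ?_).le
    exact hv (prefix_of_mem_routerGates hg hq ha)
  rw [if_pos hv]
  have single (P : Prop) [Decidable P] (g : Gate n) :
      totalOf (gateRisk ε a) (if P then [g] else []) ≤ if P then ε.gate g else 0 := by
    split_ifs
    · simpa [totalOf] using gateRisk_le ε a g
    · exact le_rfl
  simp only [routerGates, totalOf_append]
  refine add_le_add (add_le_add (add_le_add (add_le_add ?_ ?_) ?_) ?_) ?_
  · refine (single _ _).trans ?_
    simp only [Rates.gate]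
    split_ifs <;> first | exact le_rfl | assumption | (exfalso; tauto)
  · refine (single _ _).trans ?_
    simp only [Rates.gate]
    split_ifs <;> first | exact le_rfl | assumption | (exfalso; tauto)
  · refine (single _ _).trans ?_
    simp only [Rates.gate]
    split_ifs <;> first | exact le_rfl | assumption | (exfalso; tauto)
  · refine (single _ _).trans ?_
    simp only [Rates.gate]
    split_ifs <;> first | exact le_rfl | assumption | (exfalso; tauto)
  · split_ifs with h3 h4 h5
    · have hb (b : Bool) : gateRisk ε a (.longSwap (Reg.out v b) (Reg.inp (v.child b h3))) ≤
          3 * εL :=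
        (gateRisk_le ε a _).trans (mul_le_mul_of_nonneg_left (hε t ht _ _ (mem_layer.2 (Or.inr
          ⟨v, k, mem_routerGates.2 (Or.inr (Or.inr (Or.inr (Or.inr ⟨h3, h4.1, h4.2, b, rfl⟩))))⟩)))
          (by norm_num))
      have := hb false
      have := hb true
      simp only [totalOf, List.map_cons, List.map_nil, List.sum_cons, List.sum_nil]
      linarith
    · exact absurd h4.2 h5
    all_goals simp [totalOf, hL]

/-- The exact counts are 3(n + 1) + 6n(n + 1) for `εL`, (n + 1) + n for SWAPs (entering the root and
storing) and 2n(n + 1) for CSWAPs; they are rounded up using n ≥ 1. -/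
theorem totalOf_layers_le {ε : Rates} {εL : ℝ} (hε : ∀ t < 7 * n + 1, ∀ p q : Reg n,
    Gate.longSwap p q ∈ layer n t → ε.longRange (gridDist p q) ≤ εL) (hL : 0 ≤ εL)
    (a : Fin n → Bool) (hn : 1 ≤ n) :
    ∑ t ∈ Finset.range (7 * n + 1), totalOf (gateRisk ε a) (layer n t) ≤
      18 * n ^ 2 * εL + 3 * n * ε.swap + 4 * n ^ 2 * ε.cswap := by
  classical
  have h1 := ε.swap_nonneg
  have h2 := ε.cswap_nonneg
  have hload : ∑ t ∈ Finset.range (7 * n + 1), ∑ k : Ext n, totalOf (gateRisk ε a)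
      (if t = 4 * k.val then [Gate.longSwap (Reg.ext k) Reg.entry] else []) ≤ (n + 1) * (3 * εL) := by
    rw [Finset.sum_comm]
    refine (Finset.sum_le_card_nsmul _ _ (3 * εL) fun k _ => ?_).trans_eq (by simp)
    refine (Finset.sum_le_sum fun t ht => ?_).trans
      (sum_range_ite_le (m := 7 * n + 1) (t₀ := 4 * k.val) (y := 3 * εL) (by positivity))
    split_ifs with h
    · simp only [totalOf, List.map_singleton, List.sum_singleton]
      exact (gateRisk_le ε a _).trans (mul_le_mul_of_nonneg_left
        (hε t (Finset.mem_range.1 ht) _ _ (mem_layer.2 (Or.inl ⟨k, h, rfl⟩))) (by norm_num))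
    · exact le_rfl
  have hrouter : ∑ t ∈ Finset.range (7 * n + 1), ∑ v : Node n, ∑ k : Ext n,
      totalOf (gateRisk ε a) (routerGates t v k) ≤
      ∑ l ∈ Finset.range n, ((n + 1) * (if l = 0 then ε.swap else 0) + ε.swap +
        (n + 1) * (2 * ε.cswap + 6 * εL)) := by
    rw [Finset.sum_comm]
    refine (Finset.sum_le_sum fun v _ => ?_).trans (sum_ite_prefix_le a fun l => ?_)
    swap
    · split_ifs <;> positivity
    rw [Finset.sum_comm]
    refine (Finset.sum_le_sum fun k _ => Finset.sum_le_sum fun t ht =>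
      totalOf_routerGates_le hε hL a (Finset.mem_range.1 ht) v k).trans ?_
    by_cases hv : v.1 <+: List.ofFn a
    swap
    · simp [hv]
    simp only [if_pos hv]
    have hk (k : Ext n) := add_le_add (add_le_add (add_le_add (add_le_add
      (sum_range_ite_le (m := 7 * n + 1) (t₀ := 4 * k.val + 1)
        (y := if v.1.length = 0 then ε.swap else 0) (by split_ifs <;> positivity))
      (sum_range_ite_le (m := 7 * n + 1) (t₀ := 4 * k.val + 3 * v.1.length + 2)
        (y := if v.1.length = k.val then ε.swap else 0) (by split_ifs <;> positivity)))
      (sum_range_ite_le (m := 7 * n + 1) (t₀ := 4 * k.val + 3 * v.1.length + 2) h2))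
      (sum_range_ite_le (m := 7 * n + 1) (t₀ := 4 * k.val + 3 * v.1.length + 3) h2))
      (sum_range_ite_le (m := 7 * n + 1) (t₀ := 4 * k.val + 3 * v.1.length + 4)
        (y := 6 * εL) (by positivity))
    simp only [← Finset.sum_add_distrib] at hk
    refine (Finset.sum_le_sum fun k _ => hk k).trans_eq ?_
    have hstore : ∑ k : Ext n, (if v.1.length = k.val then ε.swap else 0) = ε.swap := by
      rw [Finset.sum_eq_single ⟨v.1.length, v.2.trans (Nat.lt_succ_self n)⟩]
      · simp
      · intro k _ hk
        exact if_neg fun h => hk (Fin.ext h.symm)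
      · simp
    simp only [Finset.sum_add_distrib, hstore, Finset.sum_const, Finset.card_univ,
      Fintype.card_fin, nsmul_eq_mul]
    push_cast
    ring
  have hsum : ∑ l ∈ Finset.range n, (((n : ℝ) + 1) * (if l = 0 then ε.swap else 0) + ε.swap +
        (n + 1) * (2 * ε.cswap + 6 * εL)) =
      (n + 1) * ε.swap + n * ε.swap + n * (n + 1) * (2 * ε.cswap + 6 * εL) := by
    simp only [Finset.sum_add_distrib, ← Finset.mul_sum, Finset.sum_ite_eq', Finset.mem_range,
      Finset.sum_const, Finset.card_range, nsmul_eq_mul]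
    rw [if_pos (by omega)]
    ring
  have hsplit (t : ℕ) : totalOf (gateRisk ε a) (layer n t) =
      (∑ k : Ext n, totalOf (gateRisk ε a)
        (if t = 4 * k.val then [Gate.longSwap (Reg.ext k) Reg.entry] else [])) +
      ∑ v : Node n, ∑ k : Ext n, totalOf (gateRisk ε a) (routerGates t v k) := by
    simp only [layer, totalOf_append, totalOf_flatMap, totalOf_toList, totalOf_finRange]
  simp only [hsplit, Finset.sum_add_distrib]
  refine (add_le_add hload (hrouter.trans_eq hsum)).trans ?_
  have hn' : (1 : ℝ) ≤ n := by exact_mod_cast hn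
  have e1 : 0 ≤ εL * ((n : ℝ) - 1) := mul_nonneg hL (by linarith)
  have e2 : 0 ≤ ε.swap * ((n : ℝ) - 1) := mul_nonneg h1 (by linarith)
  have e3 : 0 ≤ ε.cswap * ((n : ℝ) - 1) := mul_nonneg h2 (by linarith)
  have e4 := mul_nonneg e1 (by linarith : (0 : ℝ) ≤ n)
  have e5 := mul_nonneg e3 (by linarith : (0 : ℝ) ≤ n)
  nlinarith

theorem totalOf_loadData_le (ε : Rates) (x : (Fin n → Bool) → Bool) (a : Fin n → Bool) :
    totalOf (gateRisk ε a) (loadData x) ≤ 2 * n * ε.idle := by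
  classical
  have h := ε.idle_nonneg
  rw [loadData, totalOf_flatMap, totalOf_toList]
  refine (Finset.sum_le_sum fun v _ => ?_).trans ((sum_ite_prefix_le a
    (h := fun _ => 2 * ε.idle) fun l => by positivity).trans_eq ?_)
  · by_cases hv : v.1 <+: List.ofFn a
    · rw [if_pos hv]
      split_ifs
      · have hb (b : Bool) (d : Bool) : gateRisk ε a (.write (Reg.out v b) d) ≤ ε.idle :=
          gateRisk_le ε a _
        simp only [totalOf, List.map_cons, List.map_nil, List.sum_cons, List.sum_nil]
        have h1 := hb false (x fun m => (v.1 ++ [false]).getD m.val false)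
        have h2 := hb true (x fun m => (v.1 ++ [true]).getD m.val false)
        linarith
      · simpa [totalOf] using h
    · rw [if_neg hv]
      refine (totalOf_eq_zero fun g hg => gateRisk_of_disjoint ε fun q hq ha => ?_).le
      obtain ⟨-, hg⟩ := List.mem_ite_nil_right.1 hg
      obtain ⟨b, -, rfl⟩ := List.mem_map.1 hg
      obtain rfl : q = Reg.out v b := by simpa [Gate.support] using hq
      exact hv (prefix_of_concat_prefix ha)
  · simp
    ring

theorem totalOf_layerEvents_le {dur : ℕ → ℕ} {𝒩 : Noise n} {ε : Rates} (h𝒩 : 𝒩.IsBoundedBy ε)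
    (a : Fin n → Bool) (s : ℕ) (L : List (Gate n)) :
    totalOf (risk a) (layerEvents dur 𝒩 s L) ≤
      totalOf (gateRisk ε a) L + layerTime dur L * ((4 * n + 2) * ε.idle) := by
  classical
  have h := ε.idle_nonneg
  rw [layerEvents, totalOf_append, totalOf_flatMap, totalOf_flatMap]
  refine add_le_add (totalOf_mono fun g _ => ?_) ?_
  · simp only [totalOf, List.map_cons, List.map_nil, List.sum_cons, List.sum_nil, risk, gateRisk,
      zero_add, add_zero]
    split_ifs
    · exact le_rfl
    · exact h𝒩.1 s g
  · rw [totalOf_range]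
    refine (Finset.sum_le_card_nsmul _ _ ((4 * n + 2) * ε.idle) fun r _ => ?_).trans_eq (by simp)
    have h1 : totalOf (risk a) ((Finset.univ : Finset (Reg n)).toList.map fun q =>
        .fault _ (𝒩.idle s r q)) =
        ∑ q, risk a (.fault _ (𝒩.idle s r q)) := by
      rw [← totalOf_toList]
      simp [totalOf, Function.comp_def]
    rw [h1]
    calc ∑ q, risk a (.fault _ (𝒩.idle s r q))
        ≤ ∑ q, if q ∈ pathRegs {a} then ε.idle else 0 := by
          refine Finset.sum_le_sum fun q _ => ?_
          simp only [risk, Finset.disjoint_singleton_left]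
          split_ifs
          · exact h𝒩.2 s r q
          · exact le_rfl
      _ = (pathRegs {a}).card * ε.idle := by simp
      _ ≤ (4 * n + 2) * ε.idle :=
          mul_le_mul_of_nonneg_right (by exact_mod_cast card_pathRegs_le a) h

theorem totalOf_runEvents_le {dur : ℕ → ℕ} {𝒩 : Noise n} {ε : Rates} (h𝒩 : 𝒩.IsBoundedBy ε)
    (a : Fin n → Bool) {T : ℕ} (hT : ∀ L : List (Gate n), layerTime dur L ≤ T) (s : ℕ)
    (Ls : List (List (Gate n))) :
    totalOf (risk a) (runEvents dur 𝒩 s Ls) ≤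
      totalOf (totalOf (gateRisk ε a)) Ls + Ls.length * (T * ((4 * n + 2) * ε.idle)) := by
  induction Ls generalizing s with
  | nil => simp [runEvents, totalOf]
  | cons L Ls ih =>
    have h1 := totalOf_layerEvents_le (dur := dur) h𝒩 a s L
    have h2 : (layerTime dur L : ℝ) * ((4 * n + 2) * ε.idle) ≤ T * ((4 * n + 2) * ε.idle) :=
      mul_le_mul_of_nonneg_right (by exact_mod_cast hT L)
        (mul_nonneg (by positivity) ε.idle_nonneg)
    have h3 := ih (s + 1)
    have h4 : totalOf (totalOf (gateRisk ε a)) (L :: Ls) =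
        totalOf (gateRisk ε a) L + totalOf (totalOf (gateRisk ε a)) Ls := by simp [totalOf]
    rw [runEvents, totalOf_append, h4, List.length_cons]
    push_cast
    linarith

theorem layerTime_le (hn : 1 ≤ n) {A k : ℕ} {dur : ℕ → ℕ}
    (hdur : ∀ m, dur m ≤ A * (1 + Nat.log 2 m) ^ k) (L : List (Gate n)) :
    layerTime dur L ≤ (1 + A * 10 ^ k) * n ^ k := by
  have hone : 1 ≤ (1 + A * 10 ^ k) * n ^ k := Nat.mul_pos (by omega) (Nat.pow_pos hn)
  have hgate (g : Gate n) : g.time dur ≤ (1 + A * 10 ^ k) * n ^ k := by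
    cases g with
    | longSwap p q =>
      -- Since 144 < 2 ^ 9, the distance is below 2 ^ (n + 9). Hence 1 + log is at most n + 9 ≤ 10
      -- n, the source of the factor 10 ^ k.
      have h1 : Nat.log 2 (gridDist p q) ≤ n + 8 := by
        refine Nat.lt_succ_iff.1 (Nat.log_lt_of_lt_pow' (by omega) ?_)
        refine (gridDist_le hn p q).trans_lt ?_
        rw [show (n + 8).succ = n + 9 from rfl, pow_add]
        have : 0 < 2 ^ n := by positivity
        omega
      calc dur (gridDist p q) ≤ A * (1 + Nat.log 2 (gridDist p q)) ^ k := hdur _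
        _ ≤ A * (10 * n) ^ k := Nat.mul_le_mul_left _ (Nat.pow_le_pow_left (by omega) _)
        _ = A * 10 ^ k * n ^ k := by rw [mul_pow, mul_assoc]
        _ ≤ _ := Nat.mul_le_mul_right _ (by omega)
    | _ => exact hone
  rw [layerTime]
  induction L with
  | nil => exact hone
  | cons g L ih => exact max_le (hgate g) ih

/-- The infidelity of a noisy query, with explicit constants. -/
theorem infidelity_le (hn : 1 ≤ n) {A k : ℕ} {dur : ℕ → ℕ}
    (hdur : ∀ m, dur m ≤ A * (1 + Nat.log 2 m) ^ k) (x : (Fin n → Bool) → Bool)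
    {α : (Fin n → Bool) → ℂ} (hα : ∑ a, ‖α a‖ ^ 2 = 1) {ε : Rates} {εL : ℝ}
    (hε : ∀ L ∈ routeIn n, ∀ a b : Reg n, Gate.longSwap a b ∈ L →
      ε.longRange (gridDist a b) ≤ εL) {𝒩 : Noise n} (h𝒩 : 𝒩.IsBoundedBy ε) :
    infidelity dur 𝒩 x α ≤ (416 * (1 + A * 10 ^ k) : ℝ) *
      ((n : ℝ) ^ 2 * εL + (n : ℝ) * ε.swap + (n : ℝ) ^ 2 * ε.cswap +
        (n : ℝ) ^ (k + 2) * ε.idle) := by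
  have hε' : ∀ t < 7 * n + 1, ∀ p q : Reg n, Gate.longSwap p q ∈ layer n t →
      ε.longRange (gridDist p q) ≤ εL := fun t ht =>
    hε _ (List.mem_map.2 ⟨t, List.mem_range.2 ht, rfl⟩)
  -- Layer 0 contains the long-range SWAP of the first address qubit, which forces `εL` to be
  -- nonnegative.
  have hL : 0 ≤ εL := (ε.longRange_nonneg _).trans
    (hε' 0 (by omega) _ _ (mem_layer.2 (Or.inl ⟨0, rfl, rfl⟩)))
  have hn' : (1 : ℝ) ≤ n := by exact_mod_cast hn
  have h1 := ε.swap_nonneg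
  have h2 := ε.cswap_nonneg
  have h3 := ε.idle_nonneg
  set D : ℝ := 1 + A * 10 ^ k with hD
  have hD1 : 1 ≤ D := le_add_of_nonneg_right (by positivity)
  -- The 4 is the factor of `infidelity_le_of_risk`. The 104 is set by idling, 102 from the layers
  -- plus 2 from loading; the doubled route-in counts 36, 6 and 8 are smaller.
  rw [show 416 * D = 4 * (104 * D) by ring, mul_assoc 4]
  refine infidelity_le_of_risk hn dur 𝒩 x hα fun a => ?_
  refine (totalOf_runEvents_le h𝒩 a (layerTime_le hn hdur) 0 (circuit x)).trans ?_
  have hroute : totalOf (totalOf (gateRisk ε a)) (routeIn n) =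
      ∑ t ∈ Finset.range (7 * n + 1), totalOf (gateRisk ε a) (layer n t) := by
    rw [← totalOf_range, routeIn, totalOf, totalOf, List.map_map]
    rfl
  have hrev : totalOf (totalOf (gateRisk ε a)) (routeIn n).reverse =
      totalOf (totalOf (gateRisk ε a)) (routeIn n) := by
    rw [totalOf, List.map_reverse, List.sum_reverse, totalOf]
  have hload : totalOf (totalOf (gateRisk ε a)) [loadData x] = totalOf (gateRisk ε a) (loadData x) :=
    by simp [totalOf]
  have hlen : ((circuit x).length : ℝ) = 14 * n + 3 := by
    simp [circuit, routeIn]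
    ring
  rw [circuit, totalOf_append, totalOf_append, hrev, hload, hroute, ← circuit, hlen]
  have b1 := totalOf_layers_le hε' hL a hn
  have b2 := totalOf_loadData_le ε x a
  have hT : (((1 + A * 10 ^ k) * n ^ k : ℕ) : ℝ) = D * n ^ k := by push_cast; rfl
  rw [hT]
  have hnk : (1 : ℝ) ≤ (n : ℝ) ^ k := one_le_pow₀ hn'
  -- Number of layers times duration times registers on a path; (14n + 3)(4n + 2) = 56n² + 40n + 6,
  -- and 56 + 40 + 6 = 102.
  have b3 : (14 * (n : ℝ) + 3) * (D * n ^ k * ((4 * n + 2) * ε.idle)) ≤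
      102 * (D * (n ^ (k + 2) * ε.idle)) := by
    have : (14 * (n : ℝ) + 3) * (4 * n + 2) ≤ 102 * n ^ 2 := by nlinarith
    have hpos : 0 ≤ D * n ^ k * ε.idle := by positivity
    calc _ = ((14 * (n : ℝ) + 3) * (4 * n + 2)) * (D * n ^ k * ε.idle) := by ring
      _ ≤ (102 * n ^ 2) * (D * n ^ k * ε.idle) := mul_le_mul_of_nonneg_right this hpos
      _ = _ := by ring
  have b4 : n * ε.idle ≤ D * (n ^ (k + 2) * ε.idle) := by
    have hnk2 : (n : ℝ) ≤ n ^ (k + 2) := le_self_pow₀ hn' (by omega)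
    exact (mul_le_mul_of_nonneg_right hnk2 h3).trans
      (le_mul_of_one_le_left (by positivity) hD1)
  have c1 : 0 ≤ (D - 1) * (n ^ 2 * εL) := mul_nonneg (by linarith) (by positivity)
  have c2 : 0 ≤ (D - 1) * (n * ε.swap) := mul_nonneg (by linarith) (by positivity)
  have c3 : 0 ≤ (D - 1) * (n ^ 2 * ε.cswap) := mul_nonneg (by linarith) (by positivity)
  have d1 : 0 ≤ n ^ 2 * εL := by positivity
  have d2 : 0 ≤ n * ε.swap := by positivity
  have d3 : 0 ≤ n ^ 2 * ε.cswap := by positivity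
  nlinarith

end BucketBrigade

end

/-- Memory of `N = 2 ^ n` bits `x`, so `log N = n`. First part: the circuit is laid out in the plane
with local connectivity on a square of side `O(√N)`. Second part: if a long-range operation over
distance `m` takes time `dur m ≤ A * (1 + log m) ^ k`, then the infidelity of a noisy query with
error rates `ε`, for any input superposition `α`, is
`O(log² N * εL + log N * ε.swap + log² N * ε.cswap + polylog N * ε.idle)`, where `εL` bounds the errors
of the long-range operations. -/
theorem theorem2 :
    (∃ K : ℕ, ∀ n : ℕ, 1 ≤ n →
      (∀ x : (Fin n → Bool) → Bool, BucketBrigade.IsPlanarLocal x) ∧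
      ∀ q : BucketBrigade.Reg n,
        (BucketBrigade.place q).1.natAbs ^ 2 ≤ K * 2 ^ n ∧
        (BucketBrigade.place q).2.natAbs ^ 2 ≤ K * 2 ^ n) ∧
    ∀ A k : ℕ, ∃ (C : ℝ) (r : ℕ), ∀ n : ℕ, 1 ≤ n →
      ∀ dur : ℕ → ℕ, (∀ m, dur m ≤ A * (1 + Nat.log 2 m) ^ k) →
      ∀ x : (Fin n → Bool) → Bool,
      ∀ α : (Fin n → Bool) → ℂ, ∑ a, ‖α a‖ ^ 2 = 1 →
      ∀ (ε : BucketBrigade.Rates) (εL : ℝ),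
        (∀ L ∈ BucketBrigade.routeIn n, ∀ a b : BucketBrigade.Reg n,
          BucketBrigade.Gate.longSwap a b ∈ L →
            ε.longRange (BucketBrigade.gridDist a b) ≤ εL) →
      ∀ 𝒩 : BucketBrigade.Noise n, 𝒩.IsBoundedBy ε →
        BucketBrigade.infidelity dur 𝒩 x α ≤
          C * ((n : ℝ) ^ 2 * εL + (n : ℝ) * ε.swap + (n : ℝ) ^ 2 * ε.cswap
            + (n : ℝ) ^ r * ε.idle) := by
  refine ⟨⟨36, fun n hn => ⟨BucketBrigade.isPlanarLocal, BucketBrigade.place_bounds hn⟩⟩,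
    fun A k => ⟨416 * (1 + A * 10 ^ k), k + 2, ?_⟩⟩
  intro n hn dur hdur x α hα ε εL hε 𝒩 h𝒩
  exact BucketBrigade.infidelity_le hn hdur x hα hε h𝒩
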